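/- Let $f:\mathbb{R}^n\times\mathbb{R}^m\to\mathbb{R}$ be thrice continuously differentiable, let $\mu>0$ be such that $f(x,\cdot)$ is $\mu$-strongly concave for every $x\in\mathbb{R}^n$, and suppose that $\Phi(x):=\max_{y\in\mathbb{R}^m} f(x,y)$ is bounded below. For $\beta>\mu^{-1}$ put $$h_\beta(x,y):=f(x,y)+\tfrac{\beta}{2}\|\nabla_y f(x,y)\|^2 .$$ A differentiable function $F:\mathbb{R}^d\to\mathbb{R}$ satisfies the KL property at $\bar v$ with exponent $\theta\in[\tfrac12,1)$ if there are $C>0$ and a neighborhood $U$ of $\bar v$ such that $\|\nabla F(v)\|\ge C|F(v)-F(\bar v)|^\theta$ for all $v\in U$. *Algorithm.* Fix $x_0\in\mathbb{R}^n$, $y_0\in\mathbb{R}^m$, $\beta>\mu^{-1}$, $\eta_x,\eta_y>0$, $\alpha\in(0,1)$, $0<\gamma_x<\gamma_y<1$, $\tau\in(0,1]$, $\{\tau_k\}_k\subseteq[\tau,1]$, $a_1,a_2>0$, and let $b_1:=\beta\mu-1$, $b_2:=a_2/2$, $H_0:=h_\beta(x_0,y_0)$. For $k=0,1,2,\dots$: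 1. let $\eta_{y,k}$ be the largest $\eta\in\{\eta_y\alpha^l: l=0,1,2,\dots\}$ with $$h_\beta\big(x_k,\,y_k+\eta\nabla_y f(x_k,y_k)\big)\le H_k-\gamma_y b_1\eta\,\|\nabla_y f(x_k,y_k)\|^2,$$ and set $y_{k+1}=y_k+\eta_{y,k}\nabla_y f(x_k,y_k)$; 2. choose a direction $d_{x,k}\in\mathbb{R}^n$ with $$\|d_{x,k}\|\le a_1\|\nabla_x f(x_k,y_{k+1})\|,\qquad \langle d_{x,k},\nabla_x f(x_k,y_{k+1})\rangle\le -a_2\|\nabla_x f(x_k,y_{k+1})\|^2;$$ 3. let $\eta_{x,k}$ be the largest $\eta\in\{\eta_x\alpha^l: l=0,1,2,\dots\}$ with $$h_\beta(x_k+\eta d_{x,k},\,y_{k+1})\le H_k-\gamma_x\big(b_1\eta_{y,k}\|\nabla_y f(x_k,y_k)\|^2+b_2\,\eta\,\|\nabla_x f(x_k,y_{k+1})\|^2\big),$$ and set $x_{k+1}=x_k+\eta_{x,k}d_{x,k}$; 4. set $H_{k+1}=(1-\tau_k)H_k+\tau_k h_\beta(x_{k+1},y_{k+1})$. *Theorem.*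 Suppose that the iterates $\{(x_k,y_k)\}_{k\ge0}$ generated by the algorithm are bounded and that $\Phi$ satisfies the KL property at each of its critical points, with some exponent in $[\tfrac12,1)$ that may depend on the point. Then $(x_k,y_k)$ converges to a first-order minimax point $(x^*,y^*)$ of $\min_x\max_y f(x,y)$, that is, a point with $\nabla\Phi(x^*)=0$ and $y^*\in\arg\max_{y} f(x^*,y)$. Moreover, if $\theta$ is a KL exponent of $\Phi$ at $x^*$, or a KL exponent of $h_\beta$ at $(x^*,y^*)$, then, as $k\to\infty$, $$\|(x_k,y_k)-(x^*,y^*)\|=\begin{cases}O(q^k)\ \text{ for some } q\in(0,1), & \text{if }\theta=\tfrac12,\\[2pt] O\big(k^{-\frac{1-\theta}{2\theta-1}}\big), & \text{if }\theta\in(\tfrac12,1).\end{cases}$$ -/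

import Mathlib

open Set Filter Topology Asymptotics

noncomputable section

namespace MinimaxLS

/-- Euclidean space `ℝᵈ`. -/
abbrev E (d : ℕ) : Type := EuclideanSpace ℝ (Fin d)

/-- `ℝⁿ × ℝᵐ` with the Euclidean norm `‖(x, y)‖² = ‖x‖² + ‖y‖²`. -/
abbrev Joint (n m : ℕ) : Type := WithLp 2 (E n × E m)

/-- The point `(x, y)` of the joint Euclidean space. -/
abbrev pt {n m : ℕ} (x : E n) (y : E m) : Joint n m := WithLp.toLp 2 (x, y)

variable {n m : ℕ}

/-- The partial gradient `∇ₓ f (x, y)`. -/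
def gradX (f : E n → E m → ℝ) (x : E n) (y : E m) : E n :=
  gradient (fun x' => f x' y) x

/-- The partial gradient `∇_y f (x, y)`. -/
def gradY (f : E n → E m → ℝ) (x : E n) (y : E m) : E m :=
  gradient (fun y' => f x y') y

/-- The value function `Φ x = max_y f (x, y)`; the supremum is attained when every `f (x, ·)` is
strongly concave and continuous. -/
def valueFn (f : E n → E m → ℝ) (x : E n) : ℝ := ⨆ y, f x y

/-- The regularized objective `h_β (x, y) = f (x, y) + (β / 2) ‖∇_y f (x, y)‖²`. -/
def regObj (f : E n → E m → ℝ) (β : ℝ) (x : E n) (y : E m) : ℝ :=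
  f x y + β / 2 * ‖gradY f x y‖ ^ 2

/-- `h_β` as a function on the joint Euclidean space. -/
def regObjJoint (f : E n → E m → ℝ) (β : ℝ) (z : Joint n m) : ℝ :=
  regObj f β z.fst z.snd

/-- The basic assumptions on `f`: it is thrice continuously differentiable, `μ`-strongly concave
in `y` with `μ > 0` independent of `x`, and its value function is bounded below. -/
structure BasicAssumption (f : E n → E m → ℝ) (μ : ℝ) : Prop where
  contDiff : ContDiff ℝ 3 (fun p : E n × E m => f p.1 p.2)
  mu_pos : 0 < μ
  strongConcave : ∀ x, StrongConcaveOn univ μ (f x)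
  bddBelow : BddBelow (range (valueFn f))

/-- `(x, y)` is a first-order minimax point: `∇Φ(x) = 0` (in the sense that `Φ` is
differentiable at `x` with gradient `0`) and `y` maximizes `f (x, ·)`. -/
def IsFirstOrderMinimax (f : E n → E m → ℝ) (x : E n) (y : E m) : Prop :=
  HasGradientAt (valueFn f) 0 x ∧ IsMaxOn (f x) univ y

/-- The (differentiable) function `F` satisfies the KL property at `xbar` with
exponent `θ ∈ [1/2, 1)`. -/
def HasKLExponent {V : Type*} [NormedAddCommGroup V] [InnerProductSpace ℝ V] [CompleteSpace V]
    (F : V → ℝ) (xbar : V) (θ : ℝ) : Prop :=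
  θ ∈ Ico (1 / 2 : ℝ) 1 ∧
    ∃ C : ℝ, 0 < C ∧ ∀ᶠ x in 𝓝 xbar, C * |F x - F xbar| ^ θ ≤ ‖gradient F x‖

/-- `F` satisfies the KL property at each of its critical points. -/
def KLOnCrit {V : Type*} [NormedAddCommGroup V] [InnerProductSpace ℝ V] [CompleteSpace V]
    (F : V → ℝ) : Prop :=
  ∀ x, HasGradientAt F 0 x → ∃ θ, HasKLExponent F x θ

/-- The user-chosen parameters of the line-search framework: the regularization parameter `β`,
the initial trial step sizes `ηx`, `ηy`, the backtracking factor `α`, the sufficient-decrease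
factors `γx`, `γy`, and the averaging weights `τ k`, bounded below by `τmin`. -/
structure Params where
  β : ℝ
  ηx : ℝ
  ηy : ℝ
  α : ℝ
  γx : ℝ
  γy : ℝ
  τmin : ℝ
  τ : ℕ → ℝ

/-- The admissible ranges of the parameters. -/
structure Params.Valid (p : Params) (μ : ℝ) : Prop where
  beta : μ⁻¹ < p.β
  etaX : 0 < p.ηx
  etaY : 0 < p.ηy
  alpha : p.α ∈ Ioo (0 : ℝ) 1
  gammaX : 0 < p.γx
  gammaXY : p.γx < p.γy
  gammaY : p.γy < 1
  tauMin : p.τmin ∈ Ioc (0 : ℝ) 1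
  tau : ∀ k, p.τ k ∈ Icc p.τmin 1

/-- The sequences `(x k, y k)` are generated (without termination) by the nonmonotone line-search
framework from `(x 0, y 0)` with search directions `d k`, accepted step sizes `sx k`, `sy k` and
weighted averages `H k`. The constants of the two line-search conditions are
`b₁ = β μ - 1` and `b₂ = a₂ / 2`. -/
structure IsRun (f : E n → E m → ℝ) (μ a₂ : ℝ) (p : Params)
    (x : ℕ → E n) (y : ℕ → E m) (d : ℕ → E n) (sx sy H : ℕ → ℝ) : Prop where
  H_zero : H 0 = regObj f p.β (x 0) (y 0)
  /-- `sy k` is the largest element of `{ηy αˡ : l = 0, 1, …}` passing the test in `y`. -/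
  step_y : ∀ k, IsGreatest
    {η : ℝ | (∃ l : ℕ, η = p.ηy * p.α ^ l) ∧
      regObj f p.β (x k) (y k + η • gradY f (x k) (y k)) ≤
        H k - p.γy * (p.β * μ - 1) * η * ‖gradY f (x k) (y k)‖ ^ 2} (sy k)
  y_succ : ∀ k, y (k + 1) = y k + sy k • gradY f (x k) (y k)
  /-- `sx k` is the largest element of `{ηx αˡ : l = 0, 1, …}` passing the test in `x`. -/
  step_x : ∀ k, IsGreatest
    {η : ℝ | (∃ l : ℕ, η = p.ηx * p.α ^ l) ∧
      regObj f p.β (x k + η • d k) (y (k + 1)) ≤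
        H k - p.γx * ((p.β * μ - 1) * sy k * ‖gradY f (x k) (y k)‖ ^ 2
          + a₂ / 2 * η * ‖gradX f (x k) (y (k + 1))‖ ^ 2)} (sx k)
  x_succ : ∀ k, x (k + 1) = x k + sx k • d k
  H_succ : ∀ k, H (k + 1) =
    (1 - p.τ k) * H k + p.τ k * regObj f p.β (x (k + 1)) (y (k + 1))

/-- The directions `d k` are gradient-related at `(x k, y (k + 1))` with constants `a₁`, `a₂`. -/
def GradientRelated (f : E n → E m → ℝ) (a₁ a₂ : ℝ)
    (x : ℕ → E n) (y : ℕ → E m) (d : ℕ → E n) : Prop :=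
  ∀ k, ‖d k‖ ≤ a₁ * ‖gradX f (x k) (y (k + 1))‖ ∧
    inner ℝ (d k) (gradX f (x k) (y (k + 1))) ≤ -a₂ * ‖gradX f (x k) (y (k + 1))‖ ^ 2

end MinimaxLS

end

/-! The function h_β is a Lyapunov function for the alternating steps. Under an ascent step of size
η in y, concavity lets f rise by at most η‖∇_y f‖², while strong concavity shrinks (β/2)‖∇_y f‖² by
βμη‖∇_y f‖² to first order; since βμ > 1, the net effect is descent. The x-step decreases f, and the
cross term it creates with ∇_y f is absorbed by the slack γy - γx between the two tests. On a
bounded run the gradients are Lipschitz, so the backtracked steps stay bounded below, and both (‖∇ₓ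
f‖ + ‖∇_y f‖)² and the squared step length are O(H k - H (k+1))
(`IsRun.exists_sufficient_decrease`).

The KL property of Φ turns into a Łojasiewicz inequality for h_β with ‖∇ₓ f‖ + ‖∇_y f‖ on the right,
because h_β - Φ = O(‖∇_y f‖²) and ∇Φ(x) differs from ∇ₓ f(x, y) by O(‖∇_y f‖)
(`exists_stationarityBound_of_valueFn`). Compactness merges the inequalities at all cluster points
into one (`exists_uniform_lojasiewicz`).

Nonmonotonicity is handled by a dichotomy: either h_β at the new iterate keeps at least half of the
gap H k - ℓ, and the Łojasiewicz inequality applies there, or averaging alone closes a fixed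
fraction of the gap. Both cases give a two-step decrease of H (`exists_two_step_decrease`), hence
finite length and rates (`nonmonotone_descent_converges`). That result is used twice: with the
exponent from compactness to get convergence, and with the given θ at the limit to get the rate. -/

/-- Tangent-line inequality for the concave power t ↦ t ^ s; it is Bernoulli's inequality at b / a,
scaled by a ^ s. -/
theorem Real.mul_rpow_sub_one_mul_sub_le {s a b : ℝ} (hs : 0 ≤ s) (hs1 : s ≤ 1) (ha : 0 < a)
    (hb : 0 ≤ b) : s * a ^ (s - 1) * (a - b) ≤ a ^ s - b ^ s := by
  have h1 : (b / a) ^ s ≤ 1 + s * (b / a - 1) := by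
    have h := rpow_one_add_le_one_add_mul_self (s := b / a - 1)
      (by have := div_nonneg hb ha.le; linarith) hs hs1
    simpa using h
  have h2 : b ^ s = a ^ s * (b / a) ^ s := by
    rw [← Real.mul_rpow ha.le (div_nonneg hb ha.le), mul_div_cancel₀ _ ha.ne']
  have h3 : a ^ (s - 1) = a ^ s / a := Real.rpow_sub_one ha.ne' s
  have h4 : a ^ s * (b / a) ^ s ≤ a ^ s * (1 + s * (b / a - 1)) :=
    mul_le_mul_of_nonneg_left h1 (Real.rpow_nonneg ha.le s)
  have h5 : s * (a ^ s / a) * (a - b) = a ^ s - a ^ s * (1 + s * (b / a - 1)) := by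
    field_simp; ring
  rw [h3, h2, h5]
  linarith

/-! ### Real sequences: telescoping majorants and decay rates. -/

section RealSequences

variable {Δ : ℕ → ℝ} {θ c : ℝ} {K : ℕ}

/-- A nonnegative antitone sequence with a two-step Łojasiewicz-type decrease has summable square
roots of decrements, with an explicit telescoping majorant. -/
theorem exists_telescoping_majorant (hΔ : Antitone Δ) (h0 : ∀ k, 0 ≤ Δ k) (hθ : θ ∈ Ico (1 / 2) 1)
    (hc : 0 < c) (h1 : ∀ k, K ≤ k → Δ k ≤ 1)
    (hdec : ∀ k, K ≤ k → c * Δ (k + 1) ^ (2 * θ) ≤ Δ k - Δ (k + 2)) :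
    ∃ (W : ℕ → ℝ) (C : ℝ), (∀ k, 0 ≤ W k) ∧ (∀ k, K ≤ k → W k ≤ C * Δ k ^ (1 - θ)) ∧
      ∀ k, K ≤ k → √(Δ (k + 1) - Δ (k + 2)) ≤ W k - W (k + 1) := by
  obtain ⟨hθ1, hθ2⟩ := hθ
  have hθ' : 0 < 1 - θ := by linarith
  set A : ℝ := 1 / ((1 - θ) * √c) with hA
  have hsc : 0 < √c := Real.sqrt_pos.2 hc
  have hA0 : 0 < A := by positivity
  have hδ : ∀ k, 0 ≤ Δ k - Δ (k + 1) := fun k => sub_nonneg.2 (hΔ k.le_succ)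
  -- With r, r' consecutive roots of decrements and P the drop of Δ ^ (1 - θ), the target is 3r' ≤ r
  -- + 4AP; moving one r' to the right makes it telescope in this W.
  refine ⟨fun k => (√(Δ k - Δ (k + 1)) + 4 * A * Δ (k + 1) ^ (1 - θ)) / 2, (1 + 4 * A) / 2,
    fun k => ?_, fun k hk => ?_, fun k hk => ?_⟩
  · have := Real.rpow_nonneg (h0 (k + 1)) (1 - θ)
    positivity
  · have e1 : √(Δ k - Δ (k + 1)) ≤ Δ k ^ (1 - θ) := by
      rcases (h0 k).eq_or_lt with h | h
      · have : Δ k - Δ (k + 1) ≤ 0 := by have := h0 (k + 1); linarith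
        rw [Real.sqrt_eq_zero_of_nonpos this]
        exact Real.rpow_nonneg (h0 k) _
      · calc √(Δ k - Δ (k + 1)) ≤ √(Δ k) := Real.sqrt_le_sqrt (by linarith [h0 (k + 1)])
          _ = Δ k ^ (1 / 2 : ℝ) := Real.sqrt_eq_rpow _
          _ ≤ Δ k ^ (1 - θ) := Real.rpow_le_rpow_of_exponent_ge h (h1 k hk) (by linarith)
    have e2 : Δ (k + 1) ^ (1 - θ) ≤ Δ k ^ (1 - θ) :=
      Real.rpow_le_rpow (h0 _) (hΔ k.le_succ) hθ'.le
    have e3 := mul_le_mul_of_nonneg_left e2 (by positivity : 0 ≤ 4 * A)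
    show (_ + _) / 2 ≤ _
    linarith
  · set r := √(Δ k - Δ (k + 1)) with hr
    set r' := √(Δ (k + 1) - Δ (k + 2)) with hr'
    have hr0 : 0 ≤ r := Real.sqrt_nonneg _
    have hr0' : 0 ≤ r' := Real.sqrt_nonneg _
    have hrs : r ^ 2 = Δ k - Δ (k + 1) := Real.sq_sqrt (hδ k)
    have hrs' : r' ^ 2 = Δ (k + 1) - Δ (k + 2) := Real.sq_sqrt (hδ (k + 1))
    set P := Δ (k + 1) ^ (1 - θ) - Δ (k + 2) ^ (1 - θ) with hP
    have hP0 : 0 ≤ P := sub_nonneg.2 (Real.rpow_le_rpow (h0 _) (hΔ (Nat.le_succ _)) hθ'.le)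
    -- Concavity gives (1 - θ) r'² ≤ P Δ(k+1)^θ, and the two-step decrease gives c Δ(k+1)^(2θ) ≤ r²
    -- + r'² ≤ (r + r')².
    have key : r' ^ 2 ≤ A * P * (r + r') := by
      rcases (h0 (k + 1)).eq_or_lt with h | h
      · have : r' ^ 2 ≤ 0 := by rw [hrs']; have := h0 (k + 2); linarith
        have : 0 ≤ A * P * (r + r') := by positivity
        linarith
      · have b1 := Real.mul_rpow_sub_one_mul_sub_le hθ'.le (by linarith) h (h0 (k + 2))
        rw [show 1 - θ - 1 = -θ by ring, ← hrs', Real.rpow_neg h.le] at b1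
        have hq : 0 < Δ (k + 1) ^ θ := Real.rpow_pos_of_pos h θ
        have b2 : √c * Δ (k + 1) ^ θ ≤ r + r' := by
          have b3 := hdec k hk
          rw [two_mul, Real.rpow_add h] at b3
          refine (sq_le_sq₀ (by positivity) (by positivity)).1 ?_
          rw [mul_pow, Real.sq_sqrt hc.le]
          nlinarith [mul_nonneg hr0 hr0']
        have b4 : (1 - θ) * r' ^ 2 ≤ P * Δ (k + 1) ^ θ := by
          have := mul_le_mul_of_nonneg_right b1 hq.le
          calc _ = (1 - θ) * (Δ (k + 1) ^ θ)⁻¹ * r' ^ 2 * Δ (k + 1) ^ θ := by field_simp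
            _ ≤ _ := this
        have b5 : (1 - θ) * √c * r' ^ 2 ≤ P * (r + r') := by
          nlinarith [mul_le_mul_of_nonneg_left b2 hP0]
        calc r' ^ 2 = A * ((1 - θ) * √c * r' ^ 2) := by rw [hA]; field_simp
          _ ≤ A * (P * (r + r')) := mul_le_mul_of_nonneg_left b5 hA0.le
          _ = _ := by ring
    -- AM-GM, with weight 1/4 so that r' can be absorbed on the left.
    have key2 : r' ≤ (r + r') / 4 + A * P := by
      refine (sq_le_sq₀ (by positivity) (by positivity)).1 ?_
      nlinarith [sq_nonneg ((r + r') / 4 - A * P)]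
    show r' ≤ (r + 4 * A * Δ (k + 1) ^ (1 - θ)) / 2 - (r' + 4 * A * Δ (k + 2) ^ (1 - θ)) / 2
    have : A * P = A * Δ (k + 1) ^ (1 - θ) - A * Δ (k + 2) ^ (1 - θ) := by rw [hP]; ring
    linarith

/-- The value gap decays linearly when `θ = 1 / 2`. -/
theorem exists_geometric_bound (h0 : ∀ k, 0 ≤ Δ k) (hc : 0 < c)
    (hdec : ∀ k, K ≤ k → c * Δ (k + 2) ≤ Δ k - Δ (k + 2)) :
    ∃ A, 0 ≤ A ∧ ∃ q ∈ Ioo (0 : ℝ) 1, ∀ k, Δ (K + k) ≤ A * q ^ k := by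
  have hs : 1 < √(1 + c) := by
    rw [Real.lt_sqrt] <;> linarith
  have hq0 : 0 < (√(1 + c))⁻¹ := by positivity
  have hq2 : (√(1 + c))⁻¹ ^ 2 = (1 + c)⁻¹ := by rw [inv_pow, Real.sq_sqrt (by linarith)]
  -- Two steps contract by 1 / (1 + c), so one step counts as its square root; the constant covers
  -- the starting values of both parities.
  refine ⟨Δ K + Δ (K + 1) * √(1 + c), by have := h0 K; have := h0 (K + 1); positivity,
    (√(1 + c))⁻¹, ⟨hq0, inv_lt_one_of_one_lt₀ hs⟩, fun k => ?_⟩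
  induction k using Nat.twoStepInduction with
  | zero => have := h0 (K + 1); simp; positivity
  | one =>
    have h2 := h0 K
    have : 0 ≤ Δ K * (√(1 + c))⁻¹ := by positivity
    have h3 : Δ (K + 1) * √(1 + c) * (√(1 + c))⁻¹ = Δ (K + 1) := by field_simp
    rw [pow_one, add_mul, h3]; linarith
  | more k ih _ =>
    have h1 := hdec (K + k) (by omega)
    have h2 : Δ (K + (k + 2)) ≤ (1 + c)⁻¹ * Δ (K + k) := by
      rw [le_inv_mul_iff₀ (by linarith)]
      rw [← add_assoc]; linarith
    calc _ ≤ _ := h2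
      _ ≤ (1 + c)⁻¹ * _ := mul_le_mul_of_nonneg_left ih (by positivity)
      _ = _ := by rw [pow_add, hq2]; ring

/-- The value gap decays polynomially when the exponent `1 + s` exceeds one. -/
theorem exists_inverse_bound {s : ℝ} (hs : 0 < s) (hs1 : s ≤ 1) (h0 : ∀ k, 0 ≤ Δ k) (hc : 0 < c)
    (h1 : ∀ k, K ≤ k → Δ k ≤ 1)
    (hdec : ∀ k, K ≤ k → c * Δ (k + 2) ^ (1 + s) ≤ Δ k - Δ (k + 2)) :
    ∃ κ, 0 < κ ∧ ∀ k : ℕ, Δ (K + k) ^ s * (κ * ((k : ℝ) - 1)) ≤ 1 := by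
  -- In effect Δ ^ (-s) gains 2κ every two steps, written without division so that Δ may vanish. The
  -- shift k - 1 makes both base cases trivial.
  refine ⟨s * c / (1 + c) / 2, by positivity, fun k => ?_⟩
  induction k using Nat.twoStepInduction with
  | zero =>
    have : 0 ≤ Δ (K + 0) ^ s * (s * c / (1 + c) / 2) :=
      mul_nonneg (Real.rpow_nonneg (h0 _) _) (by positivity)
    push_cast; linarith
  | one => simp
  | more k ih _ =>
    set a := Δ (K + k) with ha
    set b := Δ (K + (k + 2)) with hb
    have hd : c * b ^ (1 + s) ≤ a - b := hdec (K + k) (by omega)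
    rcases (h0 (K + (k + 2))).eq_or_lt with h | h
    · rw [hb, ← h, Real.zero_rpow hs.ne']; simp
    · have hb0 : 0 < b := h
      have hbs : 0 < b ^ s := Real.rpow_pos_of_pos hb0 s
      have hbs1 : b ^ s ≤ 1 := Real.rpow_le_one hb0.le (h1 _ (by omega)) hs.le
      rw [Real.rpow_add hb0, Real.rpow_one] at hd
      have ha0 : 0 < a := by nlinarith [mul_pos hb0 hbs]
      have has : 0 < a ^ s := Real.rpow_pos_of_pos ha0 s
      have e1 := Real.mul_rpow_sub_one_mul_sub_le hs.le hs1 ha0 hb0.le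
      rw [Real.rpow_sub_one ha0.ne'] at e1
      -- From a - b ≥ c b^(1+s) the quotient is at least c b^s / (1 + c b^s), and b^s ≤ 1.
      have e2 : c / (1 + c) * b ^ s ≤ (a - b) / a := by
        rw [le_div_iff₀ ha0, div_mul_eq_mul_div, div_mul_eq_mul_div, div_le_iff₀ (by linarith)]
        nlinarith [mul_nonneg (mul_nonneg hc.le (le_trans (by positivity) hd)) (sub_nonneg.2 hbs1)]
      have e3 : s * a ^ s * (c / (1 + c) * b ^ s) ≤ a ^ s - b ^ s := by
        refine le_trans (mul_le_mul_of_nonneg_left e2 (by positivity)) (le_trans (le_of_eq ?_) e1)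
        ring
      set κ := s * c / (1 + c) / 2 with hκ
      have e4 : a ^ s * b ^ s * (2 * κ) ≤ a ^ s - b ^ s := by
        refine le_trans (le_of_eq ?_) e3
        rw [hκ]; ring
      have e5 : a ^ s * (b ^ s * (κ * (((k + 2 : ℕ) : ℝ) - 1))) ≤ a ^ s * 1 := by
        push_cast
        nlinarith [mul_le_mul_of_nonneg_left ih hbs.le]
      exact le_of_mul_le_mul_left e5 has

/-- A sequence whose steps are dominated by the decrements of a nonnegative sequence converges. -/
theorem exists_tendsto_of_dist_le_sub {X : Type*} [PseudoMetricSpace X] [CompleteSpace X]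
    {z : ℕ → X} {V : ℕ → ℝ} (hV : ∀ k, 0 ≤ V k)
    (hz : ∀ k, K ≤ k → dist (z k) (z (k + 1)) ≤ V k - V (k + 1)) :
    ∃ a, Tendsto z atTop (𝓝 a) ∧ ∀ k, K ≤ k → dist (z k) a ≤ V k := by
  have hd : ∀ k, K ≤ k → ∀ j, dist (z k) (z (k + j)) ≤ V k - V (k + j) := by
    intro k hk j
    induction j with
    | zero => simp
    | succ j ih =>
      calc _ ≤ dist (z k) (z (k + j)) + dist (z (k + j)) (z (k + (j + 1))) := dist_triangle _ _ _
        _ ≤ (V k - V (k + j)) + (V (k + j) - V (k + (j + 1))) :=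
          add_le_add ih (hz (k + j) (by omega))
        _ = _ := by ring
  have hc : CauchySeq (fun k => z (k + K)) := by
    have hsum : Summable fun k => V (k + K) - V (k + 1 + K) := by
      refine summable_of_sum_range_le (c := V K) (fun k => ?_) fun N => ?_
      · have := hz (k + K) (by omega)
        rw [show k + 1 + K = k + K + 1 by ring]
        exact dist_nonneg.trans this
      · rw [Finset.sum_range_sub' (fun k => V (k + K))]
        simpa using hV _
    refine cauchySeq_of_dist_le_of_summable _ (fun k => ?_) hsum
    have := hz (k + K) (by omega)
    rwa [show k + 1 + K = k + K + 1 by ring]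
  obtain ⟨a, ha⟩ := cauchySeq_tendsto_of_complete hc
  have ha' : Tendsto z atTop (𝓝 a) := (tendsto_add_atTop_iff_nat K).1 ha
  refine ⟨a, ha', fun k hk => ?_⟩
  have ht : Tendsto (fun j => dist (z k) (z (j + k))) atTop (𝓝 (dist (z k) a)) :=
    tendsto_const_nhds.dist ((tendsto_add_atTop_iff_nat k).2 ha')
  refine le_of_tendsto' ht fun j => ?_
  have := hd k hk j
  rw [add_comm] at this
  linarith [hV (j + k)]

end RealSequences

/-! ### Strongly concave functions on a Hilbert space. -/

section StrongConcavity

variable {V : Type*} [NormedAddCommGroup V] [InnerProductSpace ℝ V] [CompleteSpace V]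
  {g : V → ℝ} {μ : ℝ}

/-- The quadratic upper bound of a strongly concave function at a point of differentiability. -/
theorem StrongConcaveOn.le_add_inner_sub (h : StrongConcaveOn univ μ g) {u v : V}
    (hg : HasGradientAt g v u) (w : V) :
    g w ≤ g u + inner ℝ v (w - u) - μ / 2 * ‖w - u‖ ^ 2 := by
  have hline : HasDerivAt (fun t : ℝ => u + t • (w - u)) (w - u) 0 := by
    simpa using ((hasDerivAt_id (0 : ℝ)).smul_const (w - u)).const_add u
  have hD : HasDerivAt (fun t : ℝ => g (u + t • (w - u))) (inner ℝ v (w - u)) 0 := by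
    have h1 : HasFDerivAt g (InnerProductSpace.toDual ℝ V v) (u + (0 : ℝ) • (w - u)) := by
      simpa using hg.hasFDerivAt
    simpa using! h1.comp_hasDerivAt (0 : ℝ) hline
  have hs := hD.tendsto_slope_zero_right
  -- Strong concavity on the segment, divided by t, bounds the difference quotient below by this
  -- expression; then t → 0⁺.
  have hr : Tendsto (fun t : ℝ => g w - g u + (1 - t) * (μ / 2 * ‖w - u‖ ^ 2)) (𝓝[>] 0)
      (𝓝 (g w - g u + (1 - 0) * (μ / 2 * ‖w - u‖ ^ 2))) :=
    ((continuous_const.add ((continuous_const.sub continuous_id).mul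
      continuous_const)).tendsto 0).mono_left nhdsWithin_le_nhds
  have hle := le_of_tendsto_of_tendsto hr hs ?_
  · linarith
  · have h1 : ∀ᶠ t : ℝ in 𝓝[>] 0, t < 1 := nhdsWithin_le_nhds (Iio_mem_nhds one_pos)
    filter_upwards [self_mem_nhdsWithin, h1] with t ht0 ht1
    have ht0 : 0 < t := ht0
    have h2 := h.2 (mem_univ u) (mem_univ w) (sub_nonneg.2 ht1.le) ht0.le (by ring)
    have h3 : (1 - t) • u + t • w = u + t • (w - u) := by module
    rw [h3, norm_sub_rev u w] at h2
    simp only [smul_eq_mul, zero_add, zero_smul, add_zero] at h2 ⊢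
    rw [le_inv_mul_iff₀ ht0]
    nlinarith

theorem StrongConcaveOn.inner_gradient_sub_le (h : StrongConcaveOn univ μ g) {u u' v v' : V}
    (hu : HasGradientAt g v u) (hu' : HasGradientAt g v' u') :
    inner ℝ (v' - v) (u' - u) ≤ -μ * ‖u' - u‖ ^ 2 := by
  have h1 := h.le_add_inner_sub hu u'
  have h2 := h.le_add_inner_sub hu' u
  rw [← neg_sub u' u, inner_neg_right, norm_neg] at h2
  rw [inner_sub_left]
  linarith

theorem StrongConcaveOn.isMaxOn_of_hasGradientAt_zero (h : StrongConcaveOn univ μ g) (hμ : 0 ≤ μ)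
    {u : V} (hu : HasGradientAt g 0 u) : IsMaxOn g univ u := by
  intro w _
  have h1 := h.le_add_inner_sub hu w
  have : 0 ≤ μ / 2 * ‖w - u‖ ^ 2 := by positivity
  simp only [inner_zero_left] at h1
  show g w ≤ g u
  linarith

theorem IsMaxOn.hasGradientAt_eq_zero {u v : V} (hm : IsMaxOn g univ u) (hu : HasGradientAt g v u) :
    v = 0 := by
  have h := (hm.isLocalMax univ_mem).hasFDerivAt_eq_zero hu.hasFDerivAt
  simpa using h

/-- Error bound: strong monotonicity of the gradient between u and s, where the gradient vanishes,
followed by Cauchy–Schwarz. It lets ‖∇_y f‖ measure the distance to the inner maximizer. -/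
theorem StrongConcaveOn.norm_isMaxOn_sub_le (h : StrongConcaveOn univ μ g) (hμ : 0 < μ)
    {s u v : V} (hm : IsMaxOn g univ s) (hs : DifferentiableAt ℝ g s) (hu : HasGradientAt g v u) :
    ‖s - u‖ ≤ ‖v‖ / μ := by
  have hs' := hs.hasGradientAt
  rw [hm.hasGradientAt_eq_zero hs'] at hs'
  have h1 := h.inner_gradient_sub_le hu hs'
  rw [zero_sub, inner_neg_left] at h1
  have h2 := real_inner_le_norm v (s - u)
  rw [le_div_iff₀ hμ]
  by_contra! h3
  rcases (norm_nonneg (s - u)).eq_or_lt with h4 | h4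
  · rw [← h4] at h3; linarith [norm_nonneg v]
  · nlinarith

theorem StrongConcaveOn.isMaxOn_sub_le (h : StrongConcaveOn univ μ g) (hμ : 0 < μ)
    {s u v : V} (hm : IsMaxOn g univ s) (hs : DifferentiableAt ℝ g s) (hu : HasGradientAt g v u) :
    g s - g u ≤ ‖v‖ ^ 2 / μ := by
  have h1 := h.le_add_inner_sub hu s
  have h2 := real_inner_le_norm v (s - u)
  have h3 := mul_le_mul_of_nonneg_left (h.norm_isMaxOn_sub_le hμ hm hs hu) (norm_nonneg v)
  have h4 : 0 ≤ μ / 2 * ‖s - u‖ ^ 2 := by positivity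
  calc _ ≤ ‖v‖ * (‖v‖ / μ) := by linarith
    _ = _ := by ring

theorem StrongConcaveOn.exists_isMaxOn [ProperSpace V] (h : StrongConcaveOn univ μ g) (hμ : 0 < μ)
    (hg : Differentiable ℝ g) : ∃ s, IsMaxOn g univ s := by
  set v := gradient g 0
  have hv : HasGradientAt g v 0 := (hg 0).hasGradientAt
  -- Outside this radius the quadratic term beats the linear one, so g lies below g 0.
  obtain ⟨s, -, hs⟩ := (isCompact_closedBall (0 : V) (2 * ‖v‖ / μ)).exists_isMaxOn
    ⟨0, by simp; positivity⟩ hg.continuous.continuousOn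
  refine ⟨s, fun w _ => ?_⟩
  by_cases hw : w ∈ Metric.closedBall (0 : V) (2 * ‖v‖ / μ)
  · exact hs hw
  · have h0 : g 0 ≤ g s := hs (by simp; positivity)
    have h1 := h.le_add_inner_sub hv w
    have h2 := real_inner_le_norm v w
    rw [mem_closedBall_zero_iff, not_le, div_lt_iff₀ hμ] at hw
    rw [sub_zero] at h1
    show g w ≤ g s
    nlinarith [norm_nonneg w]

/-- First-order expansion with remainder controlled by the oscillation of the gradient. -/
theorem abs_sub_sub_inner_le {G : V → V} {s : Set V} {C : ℝ} (hs : Convex ℝ s)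
    (hg : ∀ z, HasGradientAt g (G z) z) {u w : V} (hu : u ∈ s) (hw : w ∈ s)
    (hC : ∀ z ∈ s, ‖G z - G u‖ ≤ C) : |g w - g u - inner ℝ (G u) (w - u)| ≤ C * ‖w - u‖ := by
  have := hs.norm_image_sub_le_of_norm_hasFDerivWithin_le' (f := g)
    (f' := fun z => InnerProductSpace.toDual ℝ V (G z)) (φ := InnerProductSpace.toDual ℝ V (G u))
    (C := C) (fun z _ => (hg z).hasFDerivAt.hasFDerivWithinAt)
    (fun z hz => by rw [← map_sub, LinearIsometryEquiv.norm_map]; exact hC z hz) hu hw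
  simpa using this

end StrongConcavity

/-! ### Regularity of the partial gradients and of the value function. -/

namespace MinimaxLS

variable {n m : ℕ} {f : E n → E m → ℝ} {μ : ℝ}

/-- Writing the partial gradient through the joint derivative makes its joint C² regularity in (x,
y) immediate. -/
theorem gradX_eq (hf : ContDiff ℝ 3 (fun p : E n × E m => f p.1 p.2)) (z : E n × E m) :
    gradX f z.1 z.2 = (InnerProductSpace.toDual ℝ (E n)).symm
      ((fderiv ℝ (fun p : E n × E m => f p.1 p.2) z).comp (ContinuousLinearMap.inl ℝ (E n) (E m))) := by
  have h := (hf.differentiable (by norm_num) z).hasFDerivAt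
  have h1 : HasFDerivAt (fun x : E n => (x, z.2)) (ContinuousLinearMap.inl ℝ (E n) (E m)) z.1 :=
    hasFDerivAt_prodMk_left z.1 z.2
  have h2 := HasFDerivAt.comp z.1 (g := fun p : E n × E m => f p.1 p.2) h h1
  rw [gradX, gradient]
  congr 1
  exact h2.fderiv

theorem gradY_eq (hf : ContDiff ℝ 3 (fun p : E n × E m => f p.1 p.2)) (z : E n × E m) :
    gradY f z.1 z.2 = (InnerProductSpace.toDual ℝ (E m)).symm
      ((fderiv ℝ (fun p : E n × E m => f p.1 p.2) z).comp (ContinuousLinearMap.inr ℝ (E n) (E m))) := by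
  have h := (hf.differentiable (by norm_num) z).hasFDerivAt
  have h1 : HasFDerivAt (fun y : E m => (z.1, y)) (ContinuousLinearMap.inr ℝ (E n) (E m)) z.2 :=
    hasFDerivAt_prodMk_right z.1 z.2
  have h2 := HasFDerivAt.comp z.2 (g := fun p : E n × E m => f p.1 p.2) h h1
  rw [gradY, gradient]
  congr 1
  exact h2.fderiv

theorem contDiff_gradX (hf : ContDiff ℝ 3 (fun p : E n × E m => f p.1 p.2)) :
    ContDiff ℝ 2 (fun z : E n × E m => gradX f z.1 z.2) := by
  simp_rw [gradX_eq hf]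
  have h : ContDiff ℝ 2 (fderiv ℝ (fun p : E n × E m => f p.1 p.2)) :=
    hf.fderiv_right (by norm_num)
  exact (InnerProductSpace.toDual ℝ (E n)).symm.contDiff.comp (h.clm_comp contDiff_const)

theorem contDiff_gradY (hf : ContDiff ℝ 3 (fun p : E n × E m => f p.1 p.2)) :
    ContDiff ℝ 2 (fun z : E n × E m => gradY f z.1 z.2) := by
  simp_rw [gradY_eq hf]
  have h : ContDiff ℝ 2 (fderiv ℝ (fun p : E n × E m => f p.1 p.2)) :=
    hf.fderiv_right (by norm_num)
  exact (InnerProductSpace.toDual ℝ (E m)).symm.contDiff.comp (h.clm_comp contDiff_const)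

theorem fderiv_apply_eq (hf : ContDiff ℝ 3 (fun p : E n × E m => f p.1 p.2)) (z w : E n × E m) :
    fderiv ℝ (fun p : E n × E m => f p.1 p.2) z w =
      inner ℝ (gradX f z.1 z.2) w.1 + inner ℝ (gradY f z.1 z.2) w.2 := by
  rw [gradX_eq hf, gradY_eq hf, InnerProductSpace.toDual_symm_apply,
    InnerProductSpace.toDual_symm_apply]
  simp only [ContinuousLinearMap.comp_apply, ContinuousLinearMap.inl_apply,
    ContinuousLinearMap.inr_apply]
  rw [← map_add]
  simp

theorem hasGradientAt_gradX (hf : ContDiff ℝ 3 (fun p : E n × E m => f p.1 p.2)) (x : E n)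
    (y : E m) : HasGradientAt (fun x' => f x' y) (gradX f x y) x := by
  have : DifferentiableAt ℝ (fun x' => f x' y) x :=
    (hf.differentiable (by norm_num) (x, y)).comp x
      (f := fun x' => (x', y)) (by fun_prop)
  exact this.hasGradientAt

theorem hasGradientAt_gradY (hf : ContDiff ℝ 3 (fun p : E n × E m => f p.1 p.2)) (x : E n)
    (y : E m) : HasGradientAt (f x) (gradY f x y) y := by
  have : DifferentiableAt ℝ (f x) y :=
    (hf.differentiable (by norm_num) (x, y)).comp y
      (f := fun y' => (x, y')) (by fun_prop)
  exact this.hasGradientAt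

/-- Both partial gradients are Lipschitz on balls. -/
theorem exists_lipschitz_gradients (hf : ContDiff ℝ 3 (fun p : E n × E m => f p.1 p.2)) (R : ℝ) :
    ∃ L : ℝ, 0 ≤ L ∧ ∀ z z' : E n × E m, ‖z‖ ≤ R → ‖z'‖ ≤ R →
      ‖gradX f z.1 z.2 - gradX f z'.1 z'.2‖ ≤ L * ‖z - z'‖ ∧
      ‖gradY f z.1 z.2 - gradY f z'.1 z'.2‖ ≤ L * ‖z - z'‖ := by
  obtain ⟨K₁, h₁⟩ := (contDiff_gradX hf).contDiffOn.exists_lipschitzOnWith two_ne_zero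
    (convex_closedBall (0 : E n × E m) R) (isCompact_closedBall 0 R)
  obtain ⟨K₂, h₂⟩ := (contDiff_gradY hf).contDiffOn.exists_lipschitzOnWith two_ne_zero
    (convex_closedBall (0 : E n × E m) R) (isCompact_closedBall 0 R)
  refine ⟨max K₁ K₂, le_max_of_le_left K₁.2, fun z z' hz hz' => ⟨?_, ?_⟩⟩
  · exact (h₁.norm_sub_le (by simpa using hz) (by simpa using hz')).trans
      (mul_le_mul_of_nonneg_right (le_max_left _ _) (norm_nonneg _))
  · exact (h₂.norm_sub_le (by simpa using hz) (by simpa using hz')).trans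
      (mul_le_mul_of_nonneg_right (le_max_right _ _) (norm_nonneg _))

theorem valueFn_eq {x : E n} {y : E m} (h : IsMaxOn (f x) univ y) : valueFn f x = f x y :=
  le_antisymm (ciSup_le fun w => h (mem_univ w))
    (le_ciSup (f := f x) ⟨f x y, by rintro _ ⟨w, rfl⟩; exact h (mem_univ w)⟩ y)

namespace BasicAssumption

theorem exists_isMaxOn (hf : BasicAssumption f μ) (x : E n) : ∃ y, IsMaxOn (f x) univ y :=
  (hf.strongConcave x).exists_isMaxOn hf.mu_pos
    fun y => (hasGradientAt_gradY hf.contDiff x y).differentiableAt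

theorem norm_isMaxOn_sub_le (hf : BasicAssumption f μ) {x : E n} {s : E m}
    (hs : IsMaxOn (f x) univ s) (y : E m) : ‖s - y‖ ≤ ‖gradY f x y‖ / μ :=
  (hf.strongConcave x).norm_isMaxOn_sub_le hf.mu_pos hs
    (hasGradientAt_gradY hf.contDiff x s).differentiableAt (hasGradientAt_gradY hf.contDiff x y)

theorem gradY_eq_zero (hf : BasicAssumption f μ) {x : E n} {s : E m}
    (hs : IsMaxOn (f x) univ s) : gradY f x s = 0 :=
  hs.hasGradientAt_eq_zero (hasGradientAt_gradY hf.contDiff x s)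

theorem isMaxOn_of_gradY_eq_zero (hf : BasicAssumption f μ) {x : E n} {s : E m}
    (hs : gradY f x s = 0) : IsMaxOn (f x) univ s :=
  (hf.strongConcave x).isMaxOn_of_hasGradientAt_zero hf.mu_pos.le
    (hs ▸ hasGradientAt_gradY hf.contDiff x s)

theorem abs_valueFn_sub_le (hf : BasicAssumption f μ) (x : E n) (y : E m) :
    |f x y - valueFn f x| ≤ ‖gradY f x y‖ ^ 2 / μ := by
  obtain ⟨s, hs⟩ := hf.exists_isMaxOn x
  rw [valueFn_eq hs, abs_sub_comm, abs_of_nonneg (sub_nonneg.2 (hs (mem_univ y)))]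
  exact (hf.strongConcave x).isMaxOn_sub_le hf.mu_pos hs
    (hasGradientAt_gradY hf.contDiff x s).differentiableAt (hasGradientAt_gradY hf.contDiff x y)

/-- Danskin's theorem: the value function is differentiable. -/
theorem hasGradientAt_valueFn (hf : BasicAssumption f μ) {x : E n} {y : E m}
    (hy : IsMaxOn (f x) univ y) : HasGradientAt (valueFn f) (gradX f x y) x := by
  choose s hs using hf.exists_isMaxOn
  have hst : Tendsto s (𝓝 x) (𝓝 y) := by
    rw [tendsto_iff_norm_sub_tendsto_zero]
    have h1 : Tendsto (fun x' => ‖gradY f x' y‖ / μ) (𝓝 x) (𝓝 (‖gradY f x y‖ / μ)) := by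
      have hc : Continuous fun x' => gradY f x' y :=
        (contDiff_gradY hf.contDiff).continuous.comp (f := fun x' : E n => (x', y)) (by fun_prop)
      exact ((hc.norm.div_const μ).tendsto x)
    rw [hf.gradY_eq_zero hy, norm_zero, zero_div] at h1
    exact squeeze_zero (fun _ => norm_nonneg _) (fun x' => hf.norm_isMaxOn_sub_le (hs x') y) h1
  -- Strict differentiability controls f(x', ·) - f(x, ·) both at the fixed y and at the moving
  -- maximizer s x'. These two increments bracket Φ(x') - Φ(x) by the maximality of s x' and of y.
  have hF : HasStrictFDerivAt (fun p : E n × E m => f p.1 p.2)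
      (fderiv ℝ (fun p : E n × E m => f p.1 p.2) (x, y)) (x, y) :=
    hf.contDiff.contDiffAt.hasStrictFDerivAt (by norm_num)
  rw [hasGradientAt_iff_isLittleO, Asymptotics.isLittleO_iff]
  intro c hc
  have hF1 := Asymptotics.isLittleO_iff.1 hF.isLittleO hc
  have t1 : Tendsto (fun x' => (((x', y), (x, y)) : (E n × E m) × (E n × E m))) (𝓝 x)
      (𝓝 ((x, y), (x, y))) :=
    (tendsto_id.prodMk_nhds tendsto_const_nhds).prodMk_nhds tendsto_const_nhds
  have t2 : Tendsto (fun x' => (((x', s x'), (x, s x')) : (E n × E m) × (E n × E m))) (𝓝 x)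
      (𝓝 ((x, y), (x, y))) :=
    (tendsto_id.prodMk_nhds hst).prodMk_nhds (tendsto_const_nhds.prodMk_nhds hst)
  filter_upwards [t1.eventually hF1, t2.eventually hF1] with x' h1 h2
  simp only [fderiv_apply_eq hf.contDiff, sub_self, inner_zero_right,
    add_zero, Prod.mk_sub_mk, Prod.norm_mk, norm_zero, Real.norm_eq_abs] at h1 h2
  rw [max_eq_left (norm_nonneg _), abs_le] at h1 h2
  rw [Real.norm_eq_abs, abs_le, valueFn_eq hy, valueFn_eq (hs x')]
  have m1 : f x' y ≤ f x' (s x') := hs x' (mem_univ y)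
  have m2 : f x (s x') ≤ f x y := hy (mem_univ (s x'))
  constructor <;> linarith

end BasicAssumption

end MinimaxLS

/-- Passing to the Euclidean norm on a product does not increase the norm of a derivative. -/
theorem norm_gradient_comp_ofLp_le {X Y : Type*} [NormedAddCommGroup X] [InnerProductSpace ℝ X]
    [CompleteSpace X] [NormedAddCommGroup Y] [InnerProductSpace ℝ Y] [CompleteSpace Y]
    {h : X × Y → ℝ} {z : X × Y} {T : X × Y →L[ℝ] ℝ} (hT : HasFDerivAt h T z) :
    ‖gradient (fun v : WithLp 2 (X × Y) => h (v.fst, v.snd)) (WithLp.toLp 2 z)‖ ≤ ‖T‖ := by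
  have hJ : HasFDerivAt (fun v : WithLp 2 (X × Y) => h (v.fst, v.snd))
      (T.comp (WithLp.prodContinuousLinearEquiv 2 ℝ X Y : WithLp 2 (X × Y) →L[ℝ] X × Y))
      (WithLp.toLp 2 z) :=
    HasFDerivAt.comp (WithLp.toLp 2 z) (f := WithLp.prodContinuousLinearEquiv 2 ℝ X Y) (g := h) hT
      (WithLp.prodContinuousLinearEquiv 2 ℝ X Y).hasFDerivAt
  rw [gradient, LinearIsometryEquiv.norm_map, hJ.fderiv]
  refine ContinuousLinearMap.opNorm_le_bound _ (norm_nonneg T) fun v => ?_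
  refine (T.le_opNorm _).trans (mul_le_mul_of_nonneg_left ?_ (norm_nonneg T))
  exact max_le (WithLp.norm_fst_le _ v) (WithLp.norm_snd_le _ v)

/-! ### The Łojasiewicz inequality for h_β. -/

namespace MinimaxLS

variable {n m : ℕ} {f : E n → E m → ℝ} {μ : ℝ}

/-- The Łojasiewicz inequality for `h_β`, with the stationarity measure `‖∇ₓ f‖ + ‖∇_y f‖` in place
of the norm of `∇ h_β`. -/
def StationarityBound (f : E n → E m → ℝ) (β : ℝ) (zbar : E n × E m) (θ C : ℝ) : Prop :=
  ∀ᶠ z in 𝓝 zbar, C * |regObj f β z.1 z.2 - regObj f β zbar.1 zbar.2| ^ θ ≤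
    ‖gradX f z.1 z.2‖ + ‖gradY f z.1 z.2‖

theorem continuous_regObj (hf : ContDiff ℝ 3 (fun p : E n × E m => f p.1 p.2)) (β : ℝ) :
    Continuous fun z : E n × E m => regObj f β z.1 z.2 :=
  hf.continuous.add (continuous_const.mul ((contDiff_gradY hf).continuous.norm.pow 2))

/-- At the maximizer s of f(x, ·) one has ∇Φ(x) = ∇ₓ f(x, s). Replacing s by y costs O(‖∇_y f‖) in
the gradient and O(‖∇_y f‖²) in the value; the latter, raised to θ ≥ 1/2, is again O(‖∇_y f‖). -/
theorem BasicAssumption.exists_stationarityBound_of_valueFn (hf : BasicAssumption f μ) {β : ℝ}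
    (hβ : 0 ≤ β) {z : E n × E m} {θ : ℝ} (hz : gradY f z.1 z.2 = 0)
    (hKL : HasKLExponent (valueFn f) z.1 θ) : ∃ C, 0 < C ∧ StationarityBound f β z θ C := by
  obtain ⟨⟨hθ1, hθ2⟩, C, hC, hev⟩ := hKL
  have hμ := hf.mu_pos
  have hθ0 : 0 ≤ θ := by linarith
  -- The extra 1/μ keeps s in the ball, since ‖s - y‖ ≤ 1/μ once ‖∇_y f‖ < 1.
  obtain ⟨L, hL0, hL⟩ := exists_lipschitz_gradients hf.contDiff (‖z‖ + 1 + 1 / μ)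
  have hzΦ : regObj f β z.1 z.2 = valueFn f z.1 := by
    rw [valueFn_eq (hf.isMaxOn_of_gradY_eq_zero hz), regObj, hz]; simp
  set B : ℝ := 1 / μ + β / 2 with hB
  have hB0 : 0 < B := by positivity
  set D : ℝ := B ^ θ + 1 / C + 1 / C * (L / μ) with hD
  have hD0 : 0 < D := by positivity
  refine ⟨1 / D, by positivity, ?_⟩
  have e1 : ∀ᶠ w : E n × E m in 𝓝 z, ‖gradY f w.1 w.2‖ < 1 := by
    have := (contDiff_gradY hf.contDiff).continuous.norm.tendsto z
    simp only [hz, norm_zero] at this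
    exact this.eventually (Iio_mem_nhds one_pos)
  have e2 : ∀ᶠ w : E n × E m in 𝓝 z, ‖w‖ < ‖z‖ + 1 :=
    (continuous_norm.tendsto z).eventually (Iio_mem_nhds (by linarith))
  filter_upwards [e1, e2, (continuous_fst.tendsto z).eventually hev] with w h1 h2 h3
  obtain ⟨x, y⟩ := w
  simp only at h1 h3 ⊢
  obtain ⟨s, hs⟩ := hf.exists_isMaxOn x
  rw [(hf.hasGradientAt_valueFn hs).gradient] at h3
  set gy := ‖gradY f x y‖ with hgy
  set gx := ‖gradX f x y‖ with hgx
  have hgy0 : 0 ≤ gy := norm_nonneg _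
  have hgx0 : 0 ≤ gx := norm_nonneg _
  have hsy : ‖s - y‖ ≤ gy / μ := hf.norm_isMaxOn_sub_le hs y
  have hx : ‖gradX f x s‖ ≤ gx + L / μ * gy := by
    have b1 : ‖s - y‖ ≤ 1 / μ := hsy.trans (by gcongr)
    have b2 : ‖x‖ < ‖z‖ + 1 := (norm_fst_le (x, y)).trans_lt h2
    have b3 : ‖y‖ < ‖z‖ + 1 := (norm_snd_le (x, y)).trans_lt h2
    have b4 : ‖s‖ ≤ ‖s - y‖ + ‖y‖ := by simpa using norm_add_le (s - y) y
    have hμ' : 0 < 1 / μ := by positivity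
    have b5 := (hL (x, s) (x, y)
      (by rw [Prod.norm_mk]; exact max_le (by linarith) (by linarith))
      (by linarith)).1
    simp only [Prod.mk_sub_mk, sub_self, Prod.norm_mk, norm_zero] at b5
    rw [max_eq_right (norm_nonneg _)] at b5
    have b6 : ‖gradX f x s‖ ≤ ‖gradX f x s - gradX f x y‖ + ‖gradX f x y‖ := by
      simpa using norm_add_le (gradX f x s - gradX f x y) (gradX f x y)
    have b7 : L * ‖s - y‖ ≤ L / μ * gy := by
      refine (mul_le_mul_of_nonneg_left hsy hL0).trans (le_of_eq ?_); ring
    linarith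
  have ha : |regObj f β x y - valueFn f x| ≤ B * gy ^ 2 := by
    have b1 := hf.abs_valueFn_sub_le x y
    have b2 : regObj f β x y - valueFn f x = (f x y - valueFn f x) + β / 2 * gy ^ 2 := by
      rw [regObj]; ring
    rw [b2]
    refine (abs_add_le _ _).trans ?_
    rw [abs_of_nonneg (a := β / 2 * gy ^ 2) (by positivity), hB]
    calc _ ≤ gy ^ 2 / μ + β / 2 * gy ^ 2 := by linarith
      _ = _ := by ring
  have hapow : (B * gy ^ 2) ^ θ ≤ B ^ θ * gy := by
    rw [Real.mul_rpow hB0.le (by positivity)]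
    refine mul_le_mul_of_nonneg_left ?_ (by positivity)
    rcases hgy0.eq_or_lt with h | h
    · rw [← h, zero_pow two_ne_zero, Real.zero_rpow (by linarith)]
    · rw [← Real.rpow_natCast, ← Real.rpow_mul hgy0]
      calc _ ≤ gy ^ (1 : ℝ) :=
            Real.rpow_le_rpow_of_exponent_ge h h1.le (by push_cast; linarith)
        _ = gy := Real.rpow_one _
  have htri : |regObj f β x y - regObj f β z.1 z.2| ^ θ ≤
      (B * gy ^ 2) ^ θ + |valueFn f x - valueFn f z.1| ^ θ := by
    refine le_trans (Real.rpow_le_rpow (abs_nonneg _) ?_ hθ0)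
      (Real.rpow_add_le_add_rpow (by positivity) (abs_nonneg _) hθ0 hθ2.le)
    rw [hzΦ]
    exact (abs_sub_le _ (valueFn f x) _).trans (by linarith)
  have h4 : |valueFn f x - valueFn f z.1| ^ θ ≤ 1 / C * (gx + L / μ * gy) := by
    rw [one_div, le_inv_mul_iff₀ hC]; linarith
  have h5 : |regObj f β x y - regObj f β z.1 z.2| ^ θ ≤ D * (gx + gy) := by
    have c1 : 0 ≤ B ^ θ * gx := by positivity
    have c2 : 0 ≤ 1 / C * gy := by positivity
    have c3 : 0 ≤ 1 / C * (L / μ) * gx := by positivity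
    calc _ ≤ B ^ θ * gy + 1 / C * (gx + L / μ * gy) := by linarith
      _ ≤ D * (gx + gy) := by rw [hD]; linarith
  rw [one_div, inv_mul_le_iff₀ hD0]
  exact h5

/-- The derivative of h_β is that of f plus β⟨∇_y f, T ·⟩ with T the derivative of ∇_y f, which is
locally bounded; so ‖∇h_β‖ = O(‖∇ₓ f‖ + ‖∇_y f‖). -/
theorem BasicAssumption.exists_stationarityBound_of_regObj (hf : BasicAssumption f μ) {β : ℝ}
    (hβ : 0 ≤ β) {z : E n × E m} {θ : ℝ}
    (hKL : HasKLExponent (regObjJoint f β) (pt z.1 z.2) θ) :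
    ∃ C, 0 < C ∧ StationarityBound f β z θ C := by
  obtain ⟨-, C, hC, hev⟩ := hKL
  obtain ⟨L, hL0, hL⟩ := exists_lipschitz_gradients hf.contDiff (‖z‖ + 1)
  refine ⟨C / (1 + β * L), by positivity, ?_⟩
  have hcont : Continuous fun w : E n × E m => pt w.1 w.2 :=
    WithLp.prod_continuous_toLp 2 (E n) (E m)
  have e2 : ∀ᶠ w : E n × E m in 𝓝 z, ‖w‖ < ‖z‖ + 1 :=
    (continuous_norm.tendsto z).eventually (Iio_mem_nhds (by linarith))
  filter_upwards [e2, (hcont.tendsto z).eventually hev] with w hw h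
  rw [div_mul_eq_mul_div, div_le_iff₀ (by positivity)]
  refine le_trans h ?_
  set gx := gradX f w.1 w.2 with hgx
  set gy := gradY f w.1 w.2 with hgy
  have hGd : DifferentiableAt ℝ (fun z : E n × E m => gradY f z.1 z.2) w :=
    (contDiff_gradY hf.contDiff).differentiable two_ne_zero w
  set T := fderiv ℝ (fun z : E n × E m => gradY f z.1 z.2) w with hT
  have hTn : ‖T‖ ≤ L := by
    refine hGd.hasFDerivAt.le_of_lip' hL0 ?_
    have : ∀ᶠ w' : E n × E m in 𝓝 w, ‖w'‖ < ‖z‖ + 1 :=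
      (continuous_norm.tendsto w).eventually (Iio_mem_nhds hw)
    filter_upwards [this] with w' hw'
    exact (hL w' w hw'.le hw.le).2
  have hF := (hf.contDiff.differentiable (by norm_num) w).hasFDerivAt
  have hh : HasFDerivAt (fun z : E n × E m => regObj f β z.1 z.2)
      (fderiv ℝ (fun p : E n × E m => f p.1 p.2) w +
        (β / 2) • (2 • (innerSL ℝ gy).comp T)) w :=
    hF.add ((hGd.hasFDerivAt.norm_sq).const_mul (β / 2))
  refine (norm_gradient_comp_ofLp_le hh).trans
    (ContinuousLinearMap.opNorm_le_bound _ (by positivity) fun v => ?_)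
  have n1 : ‖v.1‖ ≤ ‖v‖ := norm_fst_le v
  have n2 : ‖v.2‖ ≤ ‖v‖ := norm_snd_le v
  have hv : (fderiv ℝ (fun p : E n × E m => f p.1 p.2) w +
        (β / 2) • (2 • (innerSL ℝ gy).comp T)) v
      = inner ℝ gx v.1 + inner ℝ gy v.2 + β * inner ℝ gy (T v) := by
    have : (fderiv ℝ (fun p : E n × E m => f p.1 p.2) w +
        (β / 2) • (2 • (innerSL ℝ gy).comp T)) v
        = fderiv ℝ (fun p : E n × E m => f p.1 p.2) w v +
          (β / 2) * (2 • inner ℝ gy (T v)) := rfl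
    rw [this, fderiv_apply_eq hf.contDiff, two_smul]
    ring
  rw [hv]
  have i1 := norm_inner_le_norm (𝕜 := ℝ) gx v.1
  have i2 := norm_inner_le_norm (𝕜 := ℝ) gy v.2
  have i3 := norm_inner_le_norm (𝕜 := ℝ) gy (T v)
  have i4 : ‖T v‖ ≤ L * ‖v‖ :=
    (T.le_opNorm _).trans (mul_le_mul_of_nonneg_right hTn (norm_nonneg _))
  have i5 : ‖β * inner ℝ gy (T v)‖ ≤ β * (‖gy‖ * (L * ‖v‖)) := by
    rw [norm_mul, Real.norm_of_nonneg hβ]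
    gcongr
    exact i3.trans (by gcongr)
  calc _ ≤ ‖gx‖ * ‖v‖ + ‖gy‖ * ‖v‖ + β * (‖gy‖ * (L * ‖v‖)) := by
        refine (norm_add₃_le).trans ?_
        gcongr
        · exact i1.trans (by gcongr)
        · exact i2.trans (by gcongr)
    _ ≤ (‖gx‖ + ‖gy‖) * (1 + β * L) * ‖v‖ := by
        have : 0 ≤ ‖gx‖ * (β * L) * ‖v‖ := by positivity
        linarith

/-! ### Decrease estimates and the line search. -/

/-- Expanding ‖g'‖² around g, strong monotonicity makes the cross term at most -2μη‖g‖²; this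
outweighs the possible gain η‖g‖² of f. -/
theorem BasicAssumption.regObj_add_smul_gradY_le (hf : BasicAssumption f μ) {β L η : ℝ}
    (hβ : 0 ≤ β) (hη : 0 < η) {x : E n} {y : E m}
    (hlip : ‖gradY f x (y + η • gradY f x y) - gradY f x y‖ ≤ L * ‖η • gradY f x y‖) :
    regObj f β x (y + η • gradY f x y) ≤ regObj f β x y
      - (β * μ - 1) * η * ‖gradY f x y‖ ^ 2 + β / 2 * L ^ 2 * η ^ 2 * ‖gradY f x y‖ ^ 2 := by
  set g := gradY f x y with hg
  set g' := gradY f x (y + η • g) with hg'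
  have h0 := hasGradientAt_gradY hf.contDiff x y
  have h1 := (hf.strongConcave x).le_add_inner_sub h0 (y + η • g)
  have h2 := (hf.strongConcave x).inner_gradient_sub_le h0
    (hasGradientAt_gradY hf.contDiff x (y + η • g))
  rw [← hg] at h1
  rw [← hg, ← hg'] at h2
  rw [add_sub_cancel_left, norm_smul, Real.norm_of_nonneg hη.le, inner_smul_right] at h1 h2
  rw [norm_smul, Real.norm_of_nonneg hη.le] at hlip
  rw [real_inner_self_eq_norm_sq] at h1
  have h3 : inner ℝ (g' - g) g ≤ -μ * η * ‖g‖ ^ 2 := by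
    refine le_of_mul_le_mul_left (h2.trans (le_of_eq ?_)) hη; ring
  have h4 : ‖g'‖ ^ 2 = ‖g‖ ^ 2 + 2 * inner ℝ (g' - g) g + ‖g' - g‖ ^ 2 := by
    have := norm_add_sq_real g (g' - g)
    rw [add_sub_cancel, real_inner_comm] at this
    exact this
  have h5 : ‖g' - g‖ ^ 2 ≤ L ^ 2 * η ^ 2 * ‖g‖ ^ 2 := by
    calc _ ≤ (L * (η * ‖g‖)) ^ 2 := by gcongr
      _ = _ := by ring
  have h6 : 0 ≤ μ / 2 * (η * ‖g‖) ^ 2 := by have := hf.mu_pos; positivity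
  have h7 : β / 2 * ‖g'‖ ^ 2 ≤
      β / 2 * (‖g‖ ^ 2 + 2 * (-μ * η * ‖g‖ ^ 2) + L ^ 2 * η ^ 2 * ‖g‖ ^ 2) :=
    mul_le_mul_of_nonneg_left (by linarith) (by positivity)
  rw [regObj, regObj, ← hg, ← hg']
  linarith

/-- The penalty is estimated through ‖g'‖ ≤ ‖g‖ + Lη‖d‖, whose square produces the cross term ‖g‖‖d‖
that the slack of the y-step must later pay for. -/
theorem regObj_add_smul_le (hf : ContDiff ℝ 3 (fun p : E n × E m => f p.1 p.2)) {β L R η : ℝ}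
    (hβ : 0 ≤ β) (hL : 0 ≤ L) (hη : 0 < η)
    (hlip : ∀ z z' : E n × E m, ‖z‖ ≤ R → ‖z'‖ ≤ R →
      ‖gradX f z.1 z.2 - gradX f z'.1 z'.2‖ ≤ L * ‖z - z'‖ ∧
      ‖gradY f z.1 z.2 - gradY f z'.1 z'.2‖ ≤ L * ‖z - z'‖)
    {x d : E n} {y : E m} (hz : ‖(x, y)‖ ≤ R) (hz' : ‖(x + η • d, y)‖ ≤ R) :
    regObj f β (x + η • d) y ≤ regObj f β x y + η * inner ℝ d (gradX f x y)
      + β * L * η * ‖gradY f x y‖ * ‖d‖ + (L + β / 2 * L ^ 2) * η ^ 2 * ‖d‖ ^ 2 := by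
  have hR : ∀ w : E n, ‖w‖ ≤ R → ‖(w, y)‖ ≤ R := fun w hw =>
    max_le hw ((norm_snd_le (x, y)).trans hz)
  have hnorm : ∀ w w' : E n, ‖((w, y) : E n × E m) - (w', y)‖ = ‖w - w'‖ := fun w w' => by
    simp [Prod.norm_mk]
  have hdn : ‖x + η • d - x‖ = η * ‖d‖ := by
    rw [add_sub_cancel_left, norm_smul, Real.norm_of_nonneg hη.le]
  have hx : ‖x‖ ≤ R := (norm_fst_le (x, y)).trans hz
  have hx' : ‖x + η • d‖ ≤ R := (norm_fst_le (x + η • d, y)).trans hz'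
  have h1 := abs_sub_sub_inner_le (g := fun w => f w y) (G := fun w => gradX f w y)
    (s := segment ℝ x (x + η • d)) (C := L * (η * ‖d‖)) (convex_segment _ _)
    (fun w => hasGradientAt_gradX hf w y)
    (left_mem_segment ℝ _ _) (right_mem_segment ℝ _ _) fun w hw => by
      have hwR : ‖w‖ ≤ R := by
        have := (convex_closedBall (0 : E n) R).segment_subset (by simpa using hx)
          (by simpa using hx') hw
        simpa using this
      have := (hlip (w, y) (x, y) (hR w hwR) hz).1
      rw [hnorm] at this
      refine this.trans (mul_le_mul_of_nonneg_left ?_ hL)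
      rw [← hdn]
      have := norm_sub_le_of_mem_segment hw
      exact this
  rw [hdn, abs_le] at h1
  rw [add_sub_cancel_left, inner_smul_right, real_inner_comm] at h1
  have h2 := (hlip _ _ hz' hz).2
  rw [hnorm, hdn] at h2
  simp only at h2
  set g := gradY f x y with hg
  set g' := gradY f (x + η • d) y with hg'
  have h4 : ‖g'‖ ≤ ‖g‖ + L * (η * ‖d‖) := by
    have := norm_add_le g (g' - g)
    rw [add_sub_cancel] at this
    linarith
  have h5 : β / 2 * ‖g'‖ ^ 2 ≤ β / 2 * (‖g‖ + L * (η * ‖d‖)) ^ 2 := by gcongr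
  rw [regObj, regObj, ← hg, ← hg']
  linarith [h1.2]

/-- A backtracking step is bounded below by the first trial step known to be acceptable. -/
theorem backtracking_bounds {η₀ α s : ℝ} {P : ℝ → Prop} (hη : 0 < η₀) (hα : α ∈ Ioo (0 : ℝ) 1)
    (hs : IsGreatest {η : ℝ | (∃ l : ℕ, η = η₀ * α ^ l) ∧ P η} s) :
    0 < s ∧ s ≤ η₀ ∧ ∀ l : ℕ, P (η₀ * α ^ l) → η₀ * α ^ l ≤ s := by
  obtain ⟨⟨⟨l, rfl⟩, -⟩, hup⟩ := hs
  refine ⟨mul_pos hη (pow_pos hα.1 l), ?_, fun l' hl' => hup ⟨⟨l', rfl⟩, hl'⟩⟩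
  exact mul_le_of_le_one_right hη.le (pow_le_one₀ hα.1.le hα.2.le)

theorem exists_mul_pow_le {η₀ α t : ℝ} (hη : 0 < η₀) (hα : α ∈ Ioo (0 : ℝ) 1) (ht : 0 < t) :
    ∃ l : ℕ, η₀ * α ^ l ≤ t := by
  obtain ⟨l, hl⟩ := exists_pow_lt_of_lt_one (div_pos ht hη) hα.2
  exact ⟨l, by rw [lt_div_iff₀ hη] at hl; linarith⟩

theorem Params.Valid.b_pos {p : Params} (hp : p.Valid μ) (hμ : 0 < μ) : 0 < p.β * μ - 1 := by
  have := hp.beta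
  rw [inv_lt_iff_one_lt_mul₀ hμ] at this
  linarith

variable {p : Params} {x : ℕ → E n} {y : ℕ → E m} {d : ℕ → E n} {sx sy H : ℕ → ℝ} {a₁ a₂ : ℝ}

theorem IsRun.regObj_succ_le (hrun : IsRun f μ a₂ p x y d sx sy H) (k : ℕ) :
    regObj f p.β (x (k + 1)) (y (k + 1)) ≤
      H k - p.γx * ((p.β * μ - 1) * sy k * ‖gradY f (x k) (y k)‖ ^ 2
        + a₂ / 2 * sx k * ‖gradX f (x k) (y (k + 1))‖ ^ 2) := by
  rw [hrun.x_succ]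
  exact (hrun.step_x k).1.2

theorem IsRun.regObj_succ_le_avg (hf : BasicAssumption f μ) (hp : p.Valid μ) (ha₂ : 0 < a₂)
    (hrun : IsRun f μ a₂ p x y d sx sy H) (k : ℕ) :
    regObj f p.β (x (k + 1)) (y (k + 1)) ≤ H k := by
  have hb := hp.b_pos hf.mu_pos
  have hsy := (backtracking_bounds hp.etaY hp.alpha (hrun.step_y k)).1
  have hsx := (backtracking_bounds hp.etaX hp.alpha (hrun.step_x k)).1
  have hγ := hp.gammaX
  have h := hrun.regObj_succ_le k
  have : 0 ≤ p.γx * ((p.β * μ - 1) * sy k * ‖gradY f (x k) (y k)‖ ^ 2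
        + a₂ / 2 * sx k * ‖gradX f (x k) (y (k + 1))‖ ^ 2) := by positivity
  linarith

theorem IsRun.tau_mul_sub_le (hf : BasicAssumption f μ) (hp : p.Valid μ) (ha₂ : 0 < a₂)
    (hrun : IsRun f μ a₂ p x y d sx sy H) (k : ℕ) :
    p.τmin * (H k - regObj f p.β (x (k + 1)) (y (k + 1))) ≤ H k - H (k + 1) := by
  rw [hrun.H_succ]
  have := mul_le_mul_of_nonneg_right (hp.tau k).1
    (sub_nonneg.2 (hrun.regObj_succ_le_avg hf hp ha₂ k))
  linarith

theorem IsRun.regObj_le_avg (hf : BasicAssumption f μ) (hp : p.Valid μ) (ha₂ : 0 < a₂)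
    (hrun : IsRun f μ a₂ p x y d sx sy H) (k : ℕ) : regObj f p.β (x k) (y k) ≤ H k := by
  cases k with
  | zero => exact hrun.H_zero.ge
  | succ k =>
    rw [hrun.H_succ]
    have := mul_nonneg (sub_nonneg.2 (hp.tau k).2)
      (sub_nonneg.2 (hrun.regObj_succ_le_avg hf hp ha₂ k))
    linarith

/-- Along a bounded run, the accepted step sizes are bounded below, and the change of `∇ₓ f` over
the `y`-step is controlled by `‖∇_y f‖`. -/
theorem IsRun.exists_stepsize_lower_bound (hf : BasicAssumption f μ) (hp : p.Valid μ)
    (ha₁ : 0 < a₁) (ha₂ : 0 < a₂) (hrun : IsRun f μ a₂ p x y d sx sy H)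
    (hd : GradientRelated f a₁ a₂ x y d) {M : ℝ} (hM : ∀ k, ‖(x k, y k)‖ ≤ M) :
    ∃ Λ t : ℝ, 0 ≤ Λ ∧ 0 < t ∧ ∀ k, t ≤ sy k ∧ t ≤ sx k ∧
      ‖gradX f (x k) (y (k + 1)) - gradX f (x k) (y k)‖ ≤ Λ * ‖gradY f (x k) (y k)‖ := by
  have hμ := hf.mu_pos
  have hb := hp.b_pos hμ
  have hβ : 0 < p.β := (inv_pos.2 hμ).trans hp.beta
  have hηx := hp.etaX
  have hηy := hp.etaY
  have hγx := hp.gammaX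
  have hγ := sub_pos.2 hp.gammaXY
  have hγy := sub_pos.2 hp.gammaY
  have hτ := hp.tauMin.1
  set b := p.β * μ - 1 with hb_def
  have hMx : ∀ k, ‖x k‖ ≤ M := fun k => (norm_fst_le (x k, y k)).trans (hM k)
  have hMy : ∀ k, ‖y k‖ ≤ M := fun k => (norm_snd_le (x k, y k)).trans (hM k)
  obtain ⟨G₁, hG₁⟩ := (isCompact_closedBall (0 : E n × E m) M).exists_bound_of_continuousOn
    (contDiff_gradX hf.contDiff).continuous.continuousOn
  obtain ⟨G₂, hG₂⟩ := (isCompact_closedBall (0 : E n × E m) M).exists_bound_of_continuousOn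
    (contDiff_gradY hf.contDiff).continuous.continuousOn
  have hGx : ∀ k, ‖gradX f (x k) (y (k + 1))‖ ≤ G₁ := fun k =>
    hG₁ (x k, y (k + 1)) (by simpa [Prod.norm_mk] using ⟨hMx k, hMy (k + 1)⟩)
  have hGy : ∀ k, ‖gradY f (x k) (y k)‖ ≤ G₂ := fun k =>
    hG₂ (x k, y k) (by simpa using hM k)
  have hG₁0 : 0 ≤ G₁ := (norm_nonneg _).trans (hGx 0)
  have hG₂0 : 0 ≤ G₂ := (norm_nonneg _).trans (hGy 0)
  -- The ball is enlarged to contain trial points as well as iterates.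
  obtain ⟨L, hL0, hL⟩ := exists_lipschitz_gradients hf.contDiff (M + p.ηx * (a₁ * G₁) + p.ηy * G₂)
  have hi₁ : 0 ≤ p.ηx * (a₁ * G₁) := by positivity
  have hi₂ : 0 ≤ p.ηy * G₂ := by positivity
  have hynorm : ∀ (u : E n) (v v' : E m), ‖((u, v) : E n × E m) - (u, v')‖ = ‖v - v'‖ :=
    fun u v v' => by simp [Prod.norm_mk]
  -- Below this threshold the quadratic error uses only the fraction 1 - γy of the descent; the + 1
  -- keeps the denominator positive when L = 0.
  obtain ⟨ly, hly⟩ := exists_mul_pow_le hηy hp.alpha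
    (t := (1 - p.γy) * b / (p.β / 2 * L ^ 2 + 1)) (by positivity)
  set tY := p.ηy * p.α ^ ly with htY
  have htY0 : 0 < tY := mul_pos hηy (pow_pos hp.alpha.1 ly)
  have htYη : tY ≤ p.ηy := mul_le_of_le_one_right hηy.le (pow_le_one₀ hp.alpha.1.le hp.alpha.2.le)
  have hsyB := fun k => backtracking_bounds hηy hp.alpha (hrun.step_y k)
  have hsxB := fun k => backtracking_bounds hηx hp.alpha (hrun.step_x k)
  have hsy : ∀ k, tY ≤ sy k := fun k => by
    refine (hsyB k).2.2 ly ?_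
    set g := gradY f (x k) (y k) with hg
    have hin : ‖(x k, y k + tY • g)‖ ≤ M + p.ηx * (a₁ * G₁) + p.ηy * G₂ := by
      refine max_le (by have := hMx k; linarith) ((norm_add_le _ _).trans ?_)
      rw [norm_smul, Real.norm_of_nonneg htY0.le]
      have := mul_le_mul htYη (hGy k) (norm_nonneg _) hηy.le
      have := hMy k
      linarith
    have h1 := (hL _ (x k, y k) hin (by have := hM k; linarith)).2
    rw [hynorm, add_sub_cancel_left] at h1
    have h2 := hf.regObj_add_smul_gradY_le hβ.le htY0 h1
    rw [← hg, ← hb_def] at h2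
    have h3 := hrun.regObj_le_avg hf hp ha₂ k
    rw [le_div_iff₀ (by positivity)] at hly
    have h4 : p.β / 2 * L ^ 2 * tY ≤ (1 - p.γy) * b := by linarith
    have h5 := mul_le_mul_of_nonneg_right h4 (by positivity : 0 ≤ tY * ‖g‖ ^ 2)
    show regObj f p.β (x k) (y k + tY • g) ≤ _
    linarith
  have hdn : ∀ k, ‖d k‖ ≤ a₁ * G₁ := fun k =>
    (hd k).1.trans (mul_le_mul_of_nonneg_left (hGx k) ha₁.le)
  have hshift : ∀ k, ‖y (k + 1) - y k‖ ≤ p.ηy * ‖gradY f (x k) (y k)‖ := fun k => by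
    rw [hrun.y_succ, add_sub_cancel_left, norm_smul, Real.norm_of_nonneg (hsyB k).1.le]
    exact mul_le_mul_of_nonneg_right (hsyB k).2.1 (norm_nonneg _)
  have hxy : ∀ k, ‖(x k, y (k + 1))‖ ≤ M + p.ηx * (a₁ * G₁) + p.ηy * G₂ := fun k =>
    max_le (by have := hMx k; linarith) (by have := hMy (k + 1); linarith)
  have hlipk : ∀ k, ‖gradX f (x k) (y (k + 1)) - gradX f (x k) (y k)‖ ≤
        L * p.ηy * ‖gradY f (x k) (y k)‖ ∧
      ‖gradY f (x k) (y (k + 1)) - gradY f (x k) (y k)‖ ≤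
        L * p.ηy * ‖gradY f (x k) (y k)‖ := fun k => by
    have h1 := hL (x k, y (k + 1)) (x k, y k) (hxy k) (by have := hM k; linarith)
    rw [hynorm] at h1
    have h2 := mul_le_mul_of_nonneg_left (hshift k) hL0
    rw [← mul_assoc] at h2
    exact ⟨h1.1.trans h2, h1.2.trans h2⟩
  set A := (L + p.β / 2 * L ^ 2) * a₁ ^ 2 with hA
  set B := p.β * L * a₁ * (1 + L * p.ηy) with hB
  have hA0 : 0 ≤ A := by positivity
  have hB0 : 0 ≤ B := by positivity
  -- The first bound gives the quadratic error a quarter of a₂‖∇ₓ f‖²; the second lets the gap (γy -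
  -- γx) b₁ sy ‖∇_y f‖² pay for what Young's inequality leaves of the cross term.
  obtain ⟨lx, hlx⟩ := exists_mul_pow_le hηx hp.alpha
    (t := min (a₂ / 4 / (A + 1)) ((p.γy - p.γx) * b * tY * a₂ / (B ^ 2 + 1))) (by positivity)
  set tX := p.ηx * p.α ^ lx with htX
  have htX0 : 0 < tX := mul_pos hηx (pow_pos hp.alpha.1 lx)
  have htXη : tX ≤ p.ηx := mul_le_of_le_one_right hηx.le (pow_le_one₀ hp.alpha.1.le hp.alpha.2.le)
  have hsx : ∀ k, tX ≤ sx k := fun k => by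
    refine (hsxB k).2.2 lx ?_
    obtain ⟨hx1, hx2⟩ := le_min_iff.1 hlx
    rw [le_div_iff₀ (by positivity)] at hx1 hx2
    set g := ‖gradY f (x k) (y k)‖ with hg
    set u := ‖gradX f (x k) (y (k + 1))‖ with hu
    have hg0 : 0 ≤ g := norm_nonneg _
    have hu0 : 0 ≤ u := norm_nonneg _
    have hin : ‖(x k + tX • d k, y (k + 1))‖ ≤ M + p.ηx * (a₁ * G₁) + p.ηy * G₂ := by
      refine max_le ((norm_add_le _ _).trans ?_) (by have := hMy (k + 1); linarith)
      rw [norm_smul, Real.norm_of_nonneg htX0.le]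
      have := mul_le_mul htXη (hdn k) (norm_nonneg _) hηx.le
      have := hMx k
      linarith
    have h1 := regObj_add_smul_le hf.contDiff hβ.le hL0 htX0 hL (hxy k) hin
    have h2 : regObj f p.β (x k) (y (k + 1)) ≤ H k - p.γy * b * sy k * g ^ 2 := by
      rw [hrun.y_succ]; exact (hrun.step_y k).1.2
    have hgp : ‖gradY f (x k) (y (k + 1))‖ ≤ (1 + L * p.ηy) * g := by
      have h3 := norm_add_le (gradY f (x k) (y k))
        (gradY f (x k) (y (k + 1)) - gradY f (x k) (y k))
      rw [add_sub_cancel] at h3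
      linarith [(hlipk k).2]
    have hdk : ‖d k‖ ≤ a₁ * u := (hd k).1
    have h3 : tX * inner ℝ (d k) (gradX f (x k) (y (k + 1))) ≤ tX * (-a₂ * u ^ 2) :=
      mul_le_mul_of_nonneg_left (hd k).2 htX0.le
    have h4 : p.β * L * tX * ‖gradY f (x k) (y (k + 1))‖ * ‖d k‖ ≤ tX * (B * (g * u)) := by
      calc _ ≤ p.β * L * tX * ((1 + L * p.ηy) * g) * (a₁ * u) := by gcongr
        _ = _ := by rw [hB]; ring
    have h5 : (L + p.β / 2 * L ^ 2) * tX ^ 2 * ‖d k‖ ^ 2 ≤ tX * (A * tX * u ^ 2) := by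
      calc _ ≤ (L + p.β / 2 * L ^ 2) * tX ^ 2 * (a₁ * u) ^ 2 := by gcongr
        _ = _ := by rw [hA]; ring
    have h6 : A * tX * u ^ 2 ≤ a₂ / 4 * u ^ 2 :=
      mul_le_mul_of_nonneg_right (by linarith) (by positivity)
    have h7 : B * (g * u) ≤ a₂ / 4 * u ^ 2 + B ^ 2 / a₂ * g ^ 2 := by
      have : a₂ / 4 * u ^ 2 + B ^ 2 / a₂ * g ^ 2 - B * (g * u) =
          (a₂ * u / 2 - B * g) ^ 2 / a₂ := by field_simp; ring
      have h8 : 0 ≤ (a₂ * u / 2 - B * g) ^ 2 / a₂ := by positivity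
      linarith
    have h8 : tX * (B ^ 2 / a₂) ≤ (p.γy - p.γx) * b * sy k := by
      have h9 : tX * B ^ 2 / a₂ ≤ (p.γy - p.γx) * b * tY := by
        rw [div_le_iff₀ ha₂]; linarith
      have h10 : (p.γy - p.γx) * b * tY ≤ (p.γy - p.γx) * b * sy k :=
        mul_le_mul_of_nonneg_left (hsy k) (by positivity)
      linarith [mul_div_assoc tX (B ^ 2) a₂]
    have h9 := mul_le_mul_of_nonneg_right h8 (by positivity : 0 ≤ g ^ 2)
    have h10 := mul_le_mul_of_nonneg_left (add_le_add h6 h7) htX0.le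
    have h11 : p.γx * (a₂ / 2 * tX * u ^ 2) ≤ 1 * (a₂ / 2 * tX * u ^ 2) :=
      mul_le_mul_of_nonneg_right (by linarith) (by positivity)
    show regObj f p.β (x k + tX • d k) (y (k + 1)) ≤
      H k - p.γx * (b * sy k * g ^ 2 + a₂ / 2 * tX * u ^ 2)
    linarith
  exact ⟨L * p.ηy, min tY tX, by positivity, lt_min htY0 htX0, fun k =>
    ⟨(min_le_left _ _).trans (hsy k), (min_le_right _ _).trans (hsx k), (hlipk k).1⟩⟩

/-- Along a bounded run, the squared stationarity measure and the squared step length are bounded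
by a multiple of the decrease of the weighted average. -/
theorem IsRun.exists_sufficient_decrease (hf : BasicAssumption f μ) (hp : p.Valid μ)
    (ha₁ : 0 < a₁) (ha₂ : 0 < a₂) (hrun : IsRun f μ a₂ p x y d sx sy H)
    (hd : GradientRelated f a₁ a₂ x y d) {M : ℝ} (hM : ∀ k, ‖(x k, y k)‖ ≤ M) :
    ∃ N : ℝ, 0 < N ∧ ∀ k,
      (‖gradX f (x k) (y k)‖ + ‖gradY f (x k) (y k)‖) ^ 2 ≤ N * (H k - H (k + 1)) ∧
      dist (x k, y k) (x (k + 1), y (k + 1)) ^ 2 ≤ N * (H k - H (k + 1)) := by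
  have hb := hp.b_pos hf.mu_pos
  have hηx := hp.etaX
  have hηy := hp.etaY
  have hγx := hp.gammaX
  have hτ := hp.tauMin.1
  obtain ⟨Λ, t, hΛ, ht, hstep⟩ := hrun.exists_stepsize_lower_bound hf hp ha₁ ha₂ hd hM
  have hsyB := fun k => backtracking_bounds hηy hp.alpha (hrun.step_y k)
  have hsxB := fun k => backtracking_bounds hηx hp.alpha (hrun.step_x k)
  set κ := p.τmin * (p.γx * min ((p.β * μ - 1) * t) (a₂ / 2 * t)) with hκ
  have hκ0 : 0 < κ := by positivity
  set Q := 2 * (1 + Λ) ^ 2 + (p.ηx * a₁) ^ 2 + p.ηy ^ 2 with hQ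
  have hdec : ∀ k, κ * (‖gradY f (x k) (y k)‖ ^ 2 + ‖gradX f (x k) (y (k + 1))‖ ^ 2) ≤
      H k - H (k + 1) := fun k => by
    refine le_trans ?_ (hrun.tau_mul_sub_le hf hp ha₂ k)
    rw [hκ, mul_assoc]
    refine mul_le_mul_of_nonneg_left ?_ hτ.le
    have h1 := hrun.regObj_succ_le k
    refine le_trans ?_ (le_sub_comm.1 h1)
    rw [mul_assoc]
    refine mul_le_mul_of_nonneg_left ?_ hγx.le
    rw [mul_add]
    refine add_le_add (mul_le_mul_of_nonneg_right ((min_le_left _ _).trans ?_) (by positivity))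
      (mul_le_mul_of_nonneg_right ((min_le_right _ _).trans ?_) (by positivity))
    · exact mul_le_mul_of_nonneg_left (hstep k).1 hb.le
    · exact mul_le_mul_of_nonneg_left (hstep k).2.1 (by positivity)
  refine ⟨Q / κ, by positivity, fun k => ?_⟩
  set g := ‖gradY f (x k) (y k)‖ with hg
  set u := ‖gradX f (x k) (y (k + 1))‖ with hu
  have hg0 : 0 ≤ g := norm_nonneg _
  have hu0 : 0 ≤ u := norm_nonneg _
  have hmain : Q * (g ^ 2 + u ^ 2) ≤ Q / κ * (H k - H (k + 1)) := by
    have := mul_le_mul_of_nonneg_left (hdec k) (by positivity : 0 ≤ Q / κ)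
    rwa [← mul_assoc, div_mul_cancel₀ _ hκ0.ne'] at this
  have hs0 : 0 ≤ g ^ 2 + u ^ 2 := by positivity
  have hgs : g ^ 2 ≤ g ^ 2 + u ^ 2 := le_add_of_nonneg_right (sq_nonneg u)
  have hus : u ^ 2 ≤ g ^ 2 + u ^ 2 := le_add_of_nonneg_left (sq_nonneg g)
  have hQ1 : 0 ≤ (1 + Λ) ^ 2 := sq_nonneg _
  have hQ2 : 0 ≤ (p.ηx * a₁) ^ 2 := sq_nonneg _
  have hQ3 : 0 ≤ p.ηy ^ 2 := sq_nonneg _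
  constructor
  · refine le_trans ?_ hmain
    have h1 : ‖gradX f (x k) (y k)‖ + g ≤ (1 + Λ) * (g + u) := by
      have h2 := norm_sub_le (gradX f (x k) (y (k + 1)))
        (gradX f (x k) (y (k + 1)) - gradX f (x k) (y k))
      rw [sub_sub_cancel] at h2
      have h3 : 0 ≤ Λ * u := by positivity
      linarith [(hstep k).2.2]
    calc _ ≤ ((1 + Λ) * (g + u)) ^ 2 := by gcongr
      _ = (1 + Λ) ^ 2 * (g + u) ^ 2 := mul_pow _ _ _
      _ ≤ (1 + Λ) ^ 2 * (2 * (g ^ 2 + u ^ 2)) :=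
        mul_le_mul_of_nonneg_left (by nlinarith [sq_nonneg (g - u)]) (by positivity)
      _ = (1 + Λ) ^ 2 * 2 * (g ^ 2 + u ^ 2) := by ring
      _ ≤ Q * (g ^ 2 + u ^ 2) := mul_le_mul_of_nonneg_right (by linarith) hs0
  · refine le_trans ?_ hmain
    have h1 : ‖x (k + 1) - x k‖ ≤ p.ηx * a₁ * u := by
      rw [hrun.x_succ, add_sub_cancel_left, norm_smul, Real.norm_of_nonneg (hsxB k).1.le, mul_assoc]
      exact mul_le_mul (hsxB k).2.1 (hd k).1 (norm_nonneg _) hηx.le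
    have h2 : ‖y (k + 1) - y k‖ ≤ p.ηy * g := by
      rw [hrun.y_succ, add_sub_cancel_left, norm_smul, Real.norm_of_nonneg (hsyB k).1.le]
      exact mul_le_mul_of_nonneg_right (hsyB k).2.1 hg0
    rw [dist_comm, dist_eq_norm, Prod.mk_sub_mk, Prod.norm_mk]
    rcases max_choice ‖x (k + 1) - x k‖ ‖y (k + 1) - y k‖ with h | h
    · rw [h]
      calc _ ≤ (p.ηx * a₁ * u) ^ 2 := by gcongr
        _ = (p.ηx * a₁) ^ 2 * u ^ 2 := mul_pow _ _ _
        _ ≤ Q * (g ^ 2 + u ^ 2) := mul_le_mul (by linarith) hus (sq_nonneg u) (by linarith)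
    · rw [h]
      calc _ ≤ (p.ηy * g) ^ 2 := by gcongr
        _ = p.ηy ^ 2 * g ^ 2 := mul_pow _ _ _
        _ ≤ Q * (g ^ 2 + u ^ 2) := mul_le_mul (by linarith) hgs (sq_nonneg g) (by linarith)

end MinimaxLS

/-! ### Abstract nonmonotone descent. -/

section NonmonotoneDescent

variable {H h g : ℕ → ℝ} {ℓ τ N : ℝ}

/-- The Łojasiewicz inequality along a nonmonotone descent sequence gives a two-step decrease of the
weighted averages. -/
theorem exists_two_step_decrease (hτ : 0 < τ) (hN : 0 < N) (hH : Antitone H)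
    (hlim : Tendsto H atTop (𝓝 ℓ)) (havg : ∀ k, τ * (H k - h (k + 1)) ≤ H k - H (k + 1))
    (hgN : ∀ k, g k ^ 2 ≤ N * (H k - H (k + 1))) {θ C : ℝ}
    (hθ : θ ∈ Ico (1 / 2) 1) (hC : 0 < C) (hKL : ∀ᶠ k in atTop, C * |h k - ℓ| ^ θ ≤ g k) :
    ∃ (c : ℝ) (K : ℕ), 0 < c ∧ (∀ k, K ≤ k → H k - ℓ ≤ 1) ∧
      ∀ k, K ≤ k → c * (H (k + 1) - ℓ) ^ (2 * θ) ≤ (H k - ℓ) - (H (k + 2) - ℓ) := by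
  have hℓ : ∀ k, 0 ≤ H k - ℓ := fun k => sub_nonneg.2 (hH.le_of_tendsto hlim k)
  obtain ⟨hθ1, hθ2⟩ := hθ
  have h1 : ∀ᶠ k in atTop, H k < ℓ + 1 := hlim.eventually (Iio_mem_nhds (by linarith))
  obtain ⟨K, hK⟩ := eventually_atTop.1 (hKL.and h1)
  -- Comes from squaring C (b / 2)^θ ≤ g (k+1) and using `hgN`.
  set c₁ := C ^ 2 * (1 / 2) ^ (2 * θ) / N with hc₁
  have hc₁0 : 0 < c₁ := by positivity
  refine ⟨min c₁ (τ / 2), K, by positivity, fun k hk => by linarith [(hK k hk).2], fun k hk => ?_⟩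
  set a := H k - ℓ with ha
  set b := H (k + 1) - ℓ with hb
  have hab : b ≤ a := by rw [ha, hb]; linarith [hH k.le_succ]
  have hb0 : 0 ≤ b := hℓ _
  have ha0 : 0 ≤ a := hℓ _
  have hd1 : H (k + 1) ≤ H k := hH k.le_succ
  have hd2 : H (k + 2) ≤ H (k + 1) := hH (k + 1).le_succ
  have hbp : 0 ≤ b ^ (2 * θ) := Real.rpow_nonneg hb0 _
  -- If the new value keeps half of the gap, the Łojasiewicz inequality applies at k + 1. Otherwise
  -- H k - h (k+1) exceeds a / 2, so `havg` closes the fraction τ / 2 of the gap, and b^(2θ) ≤ b ≤ a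
  -- because the gap is at most 1.
  by_cases hcase : a / 2 ≤ h (k + 1) - ℓ
  · refine (mul_le_mul_of_nonneg_right (min_le_left _ _) hbp).trans ?_
    have e1 := (hK (k + 1) (by omega)).1
    have e2 : C * (b / 2) ^ θ ≤ g (k + 1) := by
      refine le_trans (mul_le_mul_of_nonneg_left ?_ hC.le) e1
      refine Real.rpow_le_rpow (by positivity) ?_ (by linarith)
      exact le_trans (by linarith) (le_abs_self _)
    have e3 : C ^ 2 * ((1 / 2) ^ (2 * θ) * b ^ (2 * θ)) ≤ g (k + 1) ^ 2 := by
      calc _ = (C * (b / 2) ^ θ) ^ 2 := by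
            rw [mul_pow, ← Real.mul_rpow (by norm_num) hb0, mul_comm 2 θ, Real.rpow_mul (by positivity),
              Real.rpow_two]
            congr 3; ring_nf
        _ ≤ _ := by gcongr
    have e4 := e3.trans (hgN (k + 1))
    have e5 : c₁ * b ^ (2 * θ) ≤ H (k + 1) - H (k + 2) := by
      rw [hc₁, div_mul_eq_mul_div, div_le_iff₀ hN]
      linarith
    linarith
  · refine (mul_le_mul_of_nonneg_right (min_le_right _ _) hbp).trans ?_
    have e1 : b ^ (2 * θ) ≤ b := by
      have hb1 : b ≤ 1 := by linarith [(hK (k + 1) (by omega)).2]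
      calc _ ≤ b ^ (1 : ℝ) := Real.rpow_le_rpow_of_exponent_ge_of_imp hb0 hb1 (by linarith)
            (fun _ h => by linarith)
        _ = b := Real.rpow_one b
    have e2 := havg k
    have e3 : τ * (a / 2) ≤ τ * (H k - h (k + 1)) :=
      mul_le_mul_of_nonneg_left (by linarith) hτ.le
    have e4 : τ / 2 * b ^ (2 * θ) ≤ τ * (a / 2) := by
      calc _ ≤ τ / 2 * a := mul_le_mul_of_nonneg_left (e1.trans hab) (by positivity)
        _ = _ := by ring
    linarith

/-- Convergence and rate of convergence of a nonmonotone descent sequence under the Łojasiewicz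
inequality. -/
theorem nonmonotone_descent_converges {X : Type*} [PseudoMetricSpace X] [CompleteSpace X]
    {z : ℕ → X} (hτ : 0 < τ) (hN : 0 < N) (hH : Antitone H)
    (hlim : Tendsto H atTop (𝓝 ℓ)) (havg : ∀ k, τ * (H k - h (k + 1)) ≤ H k - H (k + 1))
    (hgN : ∀ k, g k ^ 2 ≤ N * (H k - H (k + 1)))
    (hz : ∀ k, dist (z k) (z (k + 1)) ^ 2 ≤ N * (H k - H (k + 1))) {θ C : ℝ}
    (hθ : θ ∈ Ico (1 / 2) 1) (hC : 0 < C) (hKL : ∀ᶠ k in atTop, C * |h k - ℓ| ^ θ ≤ g k) :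
    ∃ a, Tendsto z atTop (𝓝 a) ∧
      (θ = 1 / 2 → ∃ q ∈ Ioo (0 : ℝ) 1, (fun k => dist (z k) a) =O[atTop] fun k : ℕ => q ^ k) ∧
      (θ ∈ Ioo (1 / 2 : ℝ) 1 → (fun k => dist (z k) a) =O[atTop]
        fun k : ℕ => (k : ℝ) ^ (-((1 - θ) / (2 * θ - 1)))) := by
  obtain ⟨c, K, hc, h1, hdec⟩ := exists_two_step_decrease hτ hN hH hlim havg hgN hθ hC hKL
  set Δ : ℕ → ℝ := fun k => H k - ℓ with hΔ
  have h0 : ∀ k, 0 ≤ Δ k := fun k => sub_nonneg.2 (hH.le_of_tendsto hlim k)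
  have hΔa : Antitone Δ := fun i j hij => sub_le_sub_right (hH hij) ℓ
  obtain ⟨W, D, hW0, hWD, hW⟩ := exists_telescoping_majorant hΔa h0 hθ hc h1 hdec
  -- The sequence is shifted by one because the majorant W k controls the decrement from k + 1 to k
  -- + 2.
  obtain ⟨a, ha, hda⟩ := exists_tendsto_of_dist_le_sub (z := fun k => z (k + 1))
    (V := fun k => √N * W k) (K := K) (fun k => mul_nonneg (Real.sqrt_nonneg _) (hW0 k))
    fun k hk => by
      rw [← mul_sub]
      refine le_trans ?_ (mul_le_mul_of_nonneg_left (hW k hk) (Real.sqrt_nonneg _))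
      rw [← Real.sqrt_mul hN.le]
      refine Real.le_sqrt_of_sq_le ((hz (k + 1)).trans (le_of_eq ?_))
      simp only [hΔ]; ring
  have hrate : ∀ k, K ≤ k → dist (z (k + 1)) a ≤ √N * |D| * Δ k ^ (1 - θ) := fun k hk => by
    refine (hda k hk).trans ?_
    rw [mul_assoc]
    refine mul_le_mul_of_nonneg_left ((hWD k hk).trans ?_) (Real.sqrt_nonneg _)
    exact mul_le_mul_of_nonneg_right (le_abs_self D) (Real.rpow_nonneg (h0 k) _)
  have hdec' : ∀ k, K ≤ k → c * Δ (k + 2) ^ (2 * θ) ≤ Δ k - Δ (k + 2) := fun k hk =>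
    (mul_le_mul_of_nonneg_left (Real.rpow_le_rpow (h0 _) (hΔa (k + 1).le_succ)
      (by linarith [hθ.1])) hc.le).trans (hdec k hk)
  refine ⟨a, (tendsto_add_atTop_iff_nat 1).1 ha, fun hθ' => ?_, fun hθ' => ?_⟩
  · subst hθ'
    obtain ⟨A, hA, q, hq, hAq⟩ := exists_geometric_bound h0 hc (K := K) fun k hk => by
      simpa using hdec' k hk
    -- Distances are of order Δ^(1/2), so the ratio is √q; the power K + 1 in the constant undoes
    -- the index shift.
    have hq' : 0 < √q := Real.sqrt_pos.2 hq.1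
    refine ⟨√q, ⟨hq', (Real.sqrt_lt' one_pos).2 (by linarith [hq.2])⟩,
      IsBigO.of_bound (√N * |D| * √A * ((√q)⁻¹) ^ (K + 1)) ?_⟩
    filter_upwards [eventually_ge_atTop (K + 1)] with k hk
    obtain ⟨j, rfl⟩ := Nat.exists_eq_add_of_le hk
    rw [Real.norm_of_nonneg dist_nonneg, Real.norm_of_nonneg (by positivity)]
    have e1 := hrate (K + j) (by omega)
    rw [show K + 1 + j = K + j + 1 by ring]
    have e2 : Δ (K + j) ^ (1 - 1 / 2 : ℝ) ≤ √A * √q ^ j := by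
      rw [show (1 - 1 / 2 : ℝ) = 1 / 2 by norm_num, ← Real.sqrt_eq_rpow]
      refine Real.sqrt_le_iff.2 ⟨by positivity, (hAq j).trans (le_of_eq ?_)⟩
      rw [mul_pow, ← pow_mul, mul_comm j 2, pow_mul, Real.sq_sqrt hA, Real.sq_sqrt hq.1.le]
    refine (e1.trans (mul_le_mul_of_nonneg_left e2 (by positivity))).trans (le_of_eq ?_)
    rw [show K + j + 1 = K + 1 + j by ring, pow_add _ (K + 1) j, inv_pow]
    field_simp
  · obtain ⟨hθ1, hθ2⟩ := hθ'
    have hs : 0 < 2 * θ - 1 := by linarith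
    obtain ⟨κ, hκ, hb⟩ := exists_inverse_bound hs (by linarith) h0 hc h1 fun k hk => by
      rw [add_sub_cancel]; exact hdec' k hk
    set r := (1 - θ) / (2 * θ - 1) with hr
    have hr0 : 0 < r := div_pos (by linarith) hs
    refine IsBigO.of_bound (√N * |D| * (κ / 2) ^ (-r)) ?_
    -- For k = K + 1 + j this threshold is exactly what gives j - 1 ≥ k / 2.
    filter_upwards [eventually_ge_atTop (2 * K + 4)] with k hk
    obtain ⟨j, rfl⟩ := Nat.exists_eq_add_of_le (show K + 1 ≤ k by omega)
    rw [Real.norm_of_nonneg dist_nonneg, Real.norm_of_nonneg (by positivity)]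
    have e1 := hrate (K + j) (by omega)
    have hkj : ((K + 1 + j : ℕ) : ℝ) / 2 ≤ (j : ℝ) - 1 := by
      have : 2 * K + 4 ≤ K + 1 + j := hk
      have : ((2 * K + 4 : ℕ) : ℝ) ≤ ((K + 1 + j : ℕ) : ℝ) := by exact_mod_cast this
      push_cast at this ⊢
      linarith
    have hk0 : (0 : ℝ) < ((K + 1 + j : ℕ) : ℝ) := by positivity
    set t := ((K + 1 + j : ℕ) : ℝ) with ht
    have e2 : Δ (K + j) ^ (1 - θ) ≤ (κ / 2) ^ (-r) * t ^ (-r) := by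
      have e3 : Δ (K + j) ^ (2 * θ - 1) * (κ / 2 * t) ≤ 1 := by
        refine le_trans (mul_le_mul_of_nonneg_left ?_ (Real.rpow_nonneg (h0 _) _)) (hb j)
        have := mul_le_mul_of_nonneg_left hkj hκ.le
        linarith
      have e4 : Δ (K + j) ^ (2 * θ - 1) ≤ (κ / 2 * t)⁻¹ := by
        rw [← one_div, le_div_iff₀ (by positivity)]; exact e3
      have e5 := Real.rpow_le_rpow (Real.rpow_nonneg (h0 _) _) e4 hr0.le
      rw [← Real.rpow_mul (h0 _), hr, mul_div_cancel₀ _ hs.ne', ← hr] at e5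
      rwa [← Real.mul_rpow (by positivity) hk0.le, Real.rpow_neg (by positivity),
        ← Real.inv_rpow (by positivity)]
    rw [show K + 1 + j = K + j + 1 by ring]
    exact (e1.trans (mul_le_mul_of_nonneg_left e2 (by positivity))).trans
      (le_of_eq (by ring))

end NonmonotoneDescent

/-! ### Compactness over cluster points, and the assembly. -/

/-- Local Łojasiewicz inequalities at all cluster points of a sequence in a compact set give one
inequality along the sequence. -/
theorem exists_uniform_lojasiewicz {X : Type*} [TopologicalSpace X] {S : Set X} (hS : IsCompact S)
    {z : ℕ → X} (hz : ∀ k, z k ∈ S) {r g : ℕ → ℝ} (hr : Tendsto r atTop (𝓝 0)) (hr0 : ∀ k, 0 ≤ r k)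
    (hloc : ∀ a ∈ S, MapClusterPt a atTop z → ∃ θ ∈ Ico (1 / 2 : ℝ) 1, ∃ C, 0 < C ∧
      ∃ U ∈ 𝓝 a, ∀ k, z k ∈ U → C * r k ^ θ ≤ g k) :
    ∃ θ ∈ Ico (1 / 2 : ℝ) 1, ∃ C, 0 < C ∧ ∀ᶠ k in atTop, C * r k ^ θ ≤ g k := by
  have hr1 : ∀ᶠ k in atTop, r k < 1 := hr.eventually (Iio_mem_nhds one_pos)
  -- Compactness induction on sets: a union takes the larger exponent and the smaller constant,
  -- which weakens both inequalities once r k < 1.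
  have main : ∃ θ ∈ Ico (1 / 2 : ℝ) 1, ∃ C, 0 < C ∧
      ∀ᶠ k in atTop, z k ∈ S → C * r k ^ θ ≤ g k := by
    refine hS.induction_on (p := fun s => ∃ θ ∈ Ico (1 / 2 : ℝ) 1, ∃ C, 0 < C ∧
      ∀ᶠ k in atTop, z k ∈ s → C * r k ^ θ ≤ g k) ?_ ?_ ?_ ?_
    · exact ⟨1 / 2, by norm_num, 1, one_pos, by simp⟩
    · rintro s t hst ⟨θ, hθ, C, hC, h⟩
      exact ⟨θ, hθ, C, hC, h.mono fun k hk hks => hk (hst hks)⟩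
    · rintro s t ⟨θ, hθ, C, hC, h⟩ ⟨θ', hθ', C', hC', h'⟩
      refine ⟨max θ θ', ⟨hθ.1.trans (le_max_left _ _), max_lt hθ.2 hθ'.2⟩, min C C',
        lt_min hC hC', ?_⟩
      filter_upwards [h, h', hr1] with k hk hk' hk1 hkst
      have hpow : ∀ ϑ ∈ Ico (1 / 2 : ℝ) 1, ϑ ≤ max θ θ' → r k ^ max θ θ' ≤ r k ^ ϑ :=
        fun ϑ hϑ hle => Real.rpow_le_rpow_of_exponent_ge_of_imp (hr0 k) hk1.le hle
          fun _ h0 => by linarith [le_max_left θ θ', hθ.1]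
      rcases hkst with hks | hkt
      · exact (mul_le_mul (min_le_left _ _) (hpow θ hθ (le_max_left _ _))
          (Real.rpow_nonneg (hr0 k) _) hC.le).trans (hk hks)
      · exact (mul_le_mul (min_le_right _ _) (hpow θ' hθ' (le_max_right _ _))
          (Real.rpow_nonneg (hr0 k) _) hC'.le).trans (hk' hkt)
    · intro a ha
      by_cases hcl : MapClusterPt a atTop z
      · obtain ⟨θ, hθ, C, hC, U, hU, h⟩ := hloc a ha hcl
        exact ⟨U, mem_nhdsWithin_of_mem_nhds hU, θ, hθ, C, hC, Eventually.of_forall h⟩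
      · rw [mapClusterPt_iff_frequently] at hcl
        -- A point that is not a cluster point has a neighbourhood eventually avoided, where the
        -- inequality is vacuous.
        push Not at hcl
        obtain ⟨U, hU, h⟩ := hcl
        refine ⟨U, mem_nhdsWithin_of_mem_nhds hU, 1 / 2, by norm_num, 1, one_pos, ?_⟩
        exact h.mono fun k hk hkU => absurd hkU hk
  obtain ⟨θ, hθ, C, hC, h⟩ := main
  exact ⟨θ, hθ, C, hC, h.mono fun k hk => hk (hz k)⟩

theorem mainTheorem6 {n m : ℕ} (f : MinimaxLS.E n → MinimaxLS.E m → ℝ) (μ : ℝ)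
    (hf : MinimaxLS.BasicAssumption f μ)
    (p : MinimaxLS.Params) (hp : p.Valid μ)
    (x : ℕ → MinimaxLS.E n) (y : ℕ → MinimaxLS.E m) (d : ℕ → MinimaxLS.E n)
    (sx sy H : ℕ → ℝ) (a₁ a₂ : ℝ) (ha₁ : 0 < a₁) (ha₂ : 0 < a₂)
    (hrun : MinimaxLS.IsRun f μ a₂ p x y d sx sy H)
    (hd : MinimaxLS.GradientRelated f a₁ a₂ x y d)
    (hbdd : ∃ M : ℝ, 0 < M ∧ ∀ k, ‖MinimaxLS.pt (x k) (y k)‖ ≤ M)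
    (hKL : MinimaxLS.KLOnCrit (MinimaxLS.valueFn f)) :
    ∃ (xs : MinimaxLS.E n) (ys : MinimaxLS.E m),
      MinimaxLS.IsFirstOrderMinimax f xs ys ∧
      Tendsto (fun k => MinimaxLS.pt (x k) (y k)) atTop (𝓝 (MinimaxLS.pt xs ys)) ∧
      ∀ θ : ℝ,
        (MinimaxLS.HasKLExponent (MinimaxLS.valueFn f) xs θ ∨
          MinimaxLS.HasKLExponent (MinimaxLS.regObjJoint f p.β) (MinimaxLS.pt xs ys) θ) →
        (θ = 1 / 2 → ∃ q ∈ Ioo (0 : ℝ) 1,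
          (fun k : ℕ => ‖MinimaxLS.pt (x k) (y k) - MinimaxLS.pt xs ys‖)
            =O[atTop] fun k : ℕ => q ^ k) ∧
        (θ ∈ Ioo (1 / 2 : ℝ) 1 →
          (fun k : ℕ => ‖MinimaxLS.pt (x k) (y k) - MinimaxLS.pt xs ys‖)
            =O[atTop] fun k : ℕ => (k : ℝ) ^ (-((1 - θ) / (2 * θ - 1)))) := by
  obtain ⟨M, -, hM⟩ := hbdd
  have hβ : 0 ≤ p.β := ((inv_pos.2 hf.mu_pos).trans hp.beta).le
  set z : ℕ → MinimaxLS.E n × MinimaxLS.E m := fun k => (x k, y k) with hz_def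
  have hzM : ∀ k, ‖z k‖ ≤ M := fun k =>
    (max_le (WithLp.norm_fst_le _ (MinimaxLS.pt (x k) (y k)))
      (WithLp.norm_snd_le _ (MinimaxLS.pt (x k) (y k)))).trans (hM k)
  obtain ⟨N, hN, hNk⟩ := hrun.exists_sufficient_decrease hf hp ha₁ ha₂ hd hzM
  set g : ℕ → ℝ := fun k =>
    ‖MinimaxLS.gradX f (x k) (y k)‖ + ‖MinimaxLS.gradY f (x k) (y k)‖ with hg_def
  set h : ℕ → ℝ := fun k => MinimaxLS.regObj f p.β (x k) (y k) with hh_def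
  have hg0 : ∀ k, 0 ≤ g k := fun k => by positivity
  have hcont := MinimaxLS.continuous_regObj hf.contDiff p.β
  have hgcont : Continuous fun w : MinimaxLS.E n × MinimaxLS.E m =>
      ‖MinimaxLS.gradX f w.1 w.2‖ + ‖MinimaxLS.gradY f w.1 w.2‖ :=
    (MinimaxLS.contDiff_gradX hf.contDiff).continuous.norm.add
      (MinimaxLS.contDiff_gradY hf.contDiff).continuous.norm
  have hS := isCompact_closedBall (0 : MinimaxLS.E n × MinimaxLS.E m) M
  have hzS : ∀ k, z k ∈ Metric.closedBall (0 : MinimaxLS.E n × MinimaxLS.E m) M := fun k => by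
    simpa using hzM k
  have hτ := hp.tauMin.1
  have havg := hrun.tau_mul_sub_le hf hp ha₂
  have hH : Antitone H := antitone_nat_of_succ_le fun k => by
    have := mul_nonneg hτ.le (sub_nonneg.2 (hrun.regObj_succ_le_avg hf hp ha₂ k))
    linarith [havg k]
  obtain ⟨ℓ, hlim⟩ : ∃ ℓ, Tendsto H atTop (𝓝 ℓ) := by
    obtain ⟨B, hB⟩ := hS.exists_bound_of_continuousOn hcont.continuousOn
    refine ⟨_, tendsto_atTop_ciInf hH ⟨-B, ?_⟩⟩
    rintro _ ⟨k, rfl⟩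
    have h1 := hB (z k) (hzS k)
    rw [Real.norm_eq_abs, abs_le] at h1
    exact h1.1.trans (hrun.regObj_le_avg hf hp ha₂ k)
  have hdiff : Tendsto (fun k => H k - H (k + 1)) atTop (𝓝 0) := by
    simpa using hlim.sub ((tendsto_add_atTop_iff_nat 1).2 hlim)
  have hhlim : Tendsto h atTop (𝓝 ℓ) := by
    -- `havg` bounds the nonnegative H k - h (k+1) by (H k - H (k+1)) / τmin, so h has the same
    -- limit as H.
    refine (tendsto_add_atTop_iff_nat 1).1 ?_
    have h1 : Tendsto (fun k => H k - h (k + 1)) atTop (𝓝 0) := by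
      refine squeeze_zero (fun k => sub_nonneg.2 (hrun.regObj_succ_le_avg hf hp ha₂ k))
        (fun k => ?_) (by simpa using hdiff.div_const p.τmin)
      rw [le_div_iff₀ hτ]; linarith [havg k]
    simpa using hlim.sub h1
  have hglim : Tendsto g atTop (𝓝 0) := by
    have h1 : Tendsto (fun k => √(N * (H k - H (k + 1)))) atTop (𝓝 0) := by
      simpa using (hdiff.const_mul N).sqrt
    exact squeeze_zero hg0 (fun k => Real.le_sqrt_of_sq_le (hNk k).1) h1
  have hcluster : ∀ a : MinimaxLS.E n × MinimaxLS.E m, MapClusterPt a atTop z →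
      MinimaxLS.gradX f a.1 a.2 = 0 ∧ MinimaxLS.gradY f a.1 a.2 = 0 ∧
        MinimaxLS.regObj f p.β a.1 a.2 = ℓ := by
    intro a ha
    obtain ⟨φ, hφ, hφa⟩ := MapClusterPt.tendsto_subseq ha
    have e1 := tendsto_nhds_unique ((hcont.tendsto a).comp hφa) (hhlim.comp hφ.tendsto_atTop)
    have e2 := tendsto_nhds_unique ((hgcont.tendsto a).comp hφa) (hglim.comp hφ.tendsto_atTop)
    rw [add_eq_zero_iff_of_nonneg (norm_nonneg _) (norm_nonneg _), norm_eq_zero, norm_eq_zero] at e2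
    exact ⟨e2.1, e2.2, e1⟩
  have hminimax : ∀ a : MinimaxLS.E n × MinimaxLS.E m, MapClusterPt a atTop z →
      MinimaxLS.IsFirstOrderMinimax f a.1 a.2 := by
    intro a ha
    obtain ⟨e1, e2, -⟩ := hcluster a ha
    have hmax := hf.isMaxOn_of_gradY_eq_zero e2
    exact ⟨e1 ▸ hf.hasGradientAt_valueFn hmax, hmax⟩
  have hr : Tendsto (fun k => |h k - ℓ|) atTop (𝓝 0) := by
    simpa using (hhlim.sub_const ℓ).abs
  obtain ⟨θ₀, hθ₀, C₀, hC₀, hKL₀⟩ := exists_uniform_lojasiewicz (g := g) hS hzS hr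
    (fun k => abs_nonneg _) fun a _ ha => by
      obtain ⟨θ, hθ⟩ := hKL a.1 (hminimax a ha).1
      obtain ⟨-, e2, e3⟩ := hcluster a ha
      obtain ⟨C, hC, hst⟩ := hf.exists_stationarityBound_of_valueFn hβ e2 hθ
      rw [MinimaxLS.StationarityBound, e3] at hst
      exact ⟨θ, hθ.1, C, hC, _, hst, fun k hk => hk⟩
  obtain ⟨a, haz, -⟩ := nonmonotone_descent_converges hτ hN hH hlim havg
    (fun k => (hNk k).1) (fun k => (hNk k).2) hθ₀ hC₀ hKL₀
  refine ⟨a.1, a.2, hminimax a haz.mapClusterPt,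
    ((WithLp.prod_continuous_toLp 2 (MinimaxLS.E n) (MinimaxLS.E m)).tendsto a).comp haz,
    fun θ hθ => ?_⟩
  obtain ⟨-, e2, e3⟩ := hcluster a haz.mapClusterPt
  have hθm : θ ∈ Ico (1 / 2 : ℝ) 1 := hθ.elim (fun h => h.1) fun h => h.1
  obtain ⟨C, hC, hst⟩ : ∃ C, 0 < C ∧ MinimaxLS.StationarityBound f p.β a θ C :=
    hθ.elim (hf.exists_stationarityBound_of_valueFn hβ e2)
      (hf.exists_stationarityBound_of_regObj hβ)
  rw [MinimaxLS.StationarityBound, e3] at hst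
  -- Once z is known to converge, the inequality with exponent θ near the limit holds along the
  -- whole tail.
  obtain ⟨a', haz', hlin, hsub⟩ := nonmonotone_descent_converges hτ hN hH hlim havg
    (fun k => (hNk k).1) (fun k => (hNk k).2) hθm hC (haz.eventually hst)
  obtain rfl := tendsto_nhds_unique haz haz'
  -- Distances so far are in the sup norm of the product; the Euclidean norm is at most twice as
  -- large.
  have hnorm : (fun k : ℕ => ‖MinimaxLS.pt (x k) (y k) - MinimaxLS.pt a.1 a.2‖)
      =O[atTop] fun k => dist (z k) a := by
    refine IsBigO.of_bound 2 (Eventually.of_forall fun k => ?_)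
    rw [norm_norm, Real.norm_of_nonneg dist_nonneg, dist_eq_norm]
    have t1 : MinimaxLS.pt (x k) (y k) - MinimaxLS.pt a.1 a.2 =
        MinimaxLS.pt (x k - a.1) 0 + MinimaxLS.pt 0 (y k - a.2) := by
      rw [← WithLp.toLp_sub, ← WithLp.toLp_add]
      simp only [Prod.mk_sub_mk, Prod.mk_add_mk, add_zero, zero_add]
    rw [t1]
    refine (norm_add_le _ _).trans ?_
    rw [WithLp.norm_toLp_fst, WithLp.norm_toLp_snd]
    have t2 : ‖x k - a.1‖ ≤ ‖z k - a‖ := norm_fst_le (z k - a)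
    have t3 : ‖y k - a.2‖ ≤ ‖z k - a‖ := norm_snd_le (z k - a)
    linarith
  exact ⟨fun h => (hlin h).imp fun q hq => ⟨hq.1, hnorm.trans hq.2⟩, fun h => hnorm.trans (hsub h)⟩
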